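/- **Setting.** A building set on $[n+1]$ is a collection $B$ of nonempty subsets of $[n+1]=\{1,\dots,n+1\}$ that contains all singletons and satisfies $S\cup T\in B$ whenever $S,T\in B$, $S\cap T\ne\emptyset$; it is connected if $[n+1]\in B$. Its nestohedron is the Minkowski sum $P_B=\sum_{S\in B}\operatorname{conv}\{e_i: i\in S\}\subset\mathbb{R}^{n+1}$, and for $S\in B\setminus\{[n+1]\}$ let $F_S$ be the face of $P_B$ on which $\sum_{i\in S}x_i$ is minimal. A polytope is flag if any collection of pairwise intersecting facets has a nonempty intersection. If $B'$ is a building set and $S\subset[n+1]$, a decomposition of $S$ by elements of $B'$ is a representation of $S$ as a disjoint union of elements of $B'$ with the least possible number of parts. **Construction.** Let $B$ be a connected building set on $[n+1]$ such that $P_B$ is flag. Choose: 1. a connected building set $B_0\subset B$ such that $P_{B_0}$ is combinatorially equivalent to the cube $I^n=[-1,1]^n$, and an isomorphism of face lattices; let it identify bijectively the elements $S\in B_0\setminus\{[n+1]\}$ with the inequalities $l_Sx\le b_S$ of the cube, where $l_S\in\{\pm e_1,\dots,\pm e_n\}$, $b_S=1$, and $F_S$ corresponds to the facet $\{x\in I^n: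 l_Sx=1\}$; 2. a chain of building sets $B_0\subset B_1\subset\dots\subset B_N=B$, where $B_{i}$ is the least building set containing $B_{i-1}\cup\{S^i\}$ for some inclusion-minimal element $S^i$ of $B\setminus B_{i-1}$; 3. a numbering $S_1,\dots,S_M$ of $B\setminus B_0$ in which the elements of $B_{i}$ precede those outside $B_{i}$, and which reverses inclusion inside each $B_i\setminus B_{i-1}$. For $S_j\in B_i\setminus B_{i-1}$ let $S_j=S_{j_1}\sqcup S_{j_2}$ be its decomposition by elements of $B_{i-1}$ (which has exactly two parts), and define recursively $$l_{S_j}=l_{S_{j_1}}+l_{S_{j_2}},\qquad b_{S_j}=b_{S_{j_1}}+b_{S_{j_2}}-\varepsilon_j ,$$ where $\varepsilon_j>0$ is so small that the inequality $l_{S_j}x\le b_{S_j}$ shaves off the face $\{l_{S_{j_1}}x=b_{S_{j_1}},\ l_{S_{j_2}}x=b_{S_{j_2}}\}$ of the polytope $P_{j-1}$ given by the preceding inequalities (those of the cube and those with numbers less than $j$); that is, $l_{S_j}v<b_{S_j}$ for every vertex $v$ of $P_{j-1}$ that is not on this face. **Proposition.** For all such choices, the resulting realization $$P=\{x\in\mathbb{R}^n:\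 l_Sx\le b_S\ \text{ for all } S\in B\setminus\{[n+1]\}\}$$ of $P_B$ is Delzant in the standard basis of $\mathbb{R}^n$: $P$ is an $n$-dimensional convex polytope, and for every vertex $v$ of $P$ there are integer outer normals to the facets of $P$ containing $v$, one for each facet, that form a $\mathbb{Z}$-basis of $\mathbb{Z}^n$. Moreover, for every vertex $v$ the vectors $l_S$ with $S\in B\setminus\{[n+1]\}$ and $l_Sv=b_S$ form a $\mathbb{Z}$-basis of $\mathbb{Z}^n$. -/

import Mathlib

namespace Nesto

/-! ### Polytopes, faces, facets -/

section Polytopes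

variable {E : Type*} [AddCommGroup E] [Module ℝ E] [TopologicalSpace E]

/-- The dimension of a subset of a real vector space: the dimension of its affine hull. -/
noncomputable def affDim (P : Set E) : ℕ := Module.finrank ℝ (vectorSpan ℝ P)

/-- `P` is a convex polytope: the convex hull of a finite set of points. -/
def IsPolytope (P : Set E) : Prop := ∃ s : Set E, s.Finite ∧ P = convexHull ℝ s

/-- The faces of a polytope `P`: the empty face, and the subsets of `P` on which a linear function
attains its maximum over `P` (so `P` is a face). Ordered by inclusion they form the face lattice. -/
abbrev Face (P : Set E) : Type _ := {F : Set E // IsExposed ℝ P F}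

/-- `F` is a facet of the polytope `P`: a nonempty face of dimension `dim P - 1`. -/
def IsFacet (P F : Set E) : Prop :=
  IsExposed ℝ P F ∧ F.Nonempty ∧ affDim F + 1 = affDim P

/-- A polytope is flag if every collection of pairwise intersecting facets has a common point. -/
def IsFlag (P : Set E) : Prop :=
  ∀ 𝓕 : Set (Set E), (∀ F ∈ 𝓕, IsFacet P F) → (∀ F ∈ 𝓕, ∀ G ∈ 𝓕, (F ∩ G).Nonempty) →
    (⋂₀ 𝓕).Nonempty

end Polytopes

/-! ### Delzant polytopes -/

/-- The standard pairing of an integer vector with a real vector. -/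
def pairing {n : ℕ} (w : Fin n → ℤ) (x : Fin n → ℝ) : ℝ := ∑ i, (w i : ℝ) * x i

/-- The integer vector `w` is an outer normal to the face `F` of `P`:
`F` is the set of all points of `P` at which `w` is maximal on `P`. -/
def IsOuterNormal {n : ℕ} (P F : Set (Fin n → ℝ)) (w : Fin n → ℤ) : Prop :=
  w ≠ 0 ∧ F = {x ∈ P | ∀ y ∈ P, pairing w y ≤ pairing w x}

/-- `P ⊂ ℝⁿ` is a (full-dimensional) polytope that is Delzant in the standard basis of `ℝⁿ`:
at every vertex `v` one can choose, for each facet through `v`, an integer outer normal, such that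
the chosen vectors form a `ℤ`-basis of `ℤⁿ` (indexed by the facets through `v`). -/
structure IsDelzant {n : ℕ} (P : Set (Fin n → ℝ)) : Prop where
  isPolytope : IsPolytope P
  fullDim : affDim P = n
  basis_at_vertex : ∀ v ∈ P.extremePoints ℝ,
    ∃ a : Module.Basis {F : Set (Fin n → ℝ) // IsFacet P F ∧ v ∈ F} ℤ (Fin n → ℤ),
      ∀ F, IsOuterNormal P F.1 (a F)

/-! ### Building sets and nestohedra -/

/-- A building set on `{0, …, n}`. -/
structure IsBuildingSet {n : ℕ} (B : Finset (Finset (Fin (n + 1)))) : Prop where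
  nonempty_of_mem : ∀ S ∈ B, S.Nonempty
  singleton_mem : ∀ i, {i} ∈ B
  union_mem : ∀ S ∈ B, ∀ T ∈ B, (S ∩ T).Nonempty → S ∪ T ∈ B

/-- `C` is the closure of the collection `A`: the least building set containing `A`. -/
def IsClosureOf {n : ℕ} (A C : Finset (Finset (Fin (n + 1)))) : Prop :=
  IsLeast {C' | IsBuildingSet C' ∧ A ⊆ C'} C

/-- The simplex `Δ^S = conv {e_i, i ∈ S}` in `ℝ^{n+1}`. -/
def simplex {n : ℕ} (S : Finset (Fin (n + 1))) : Set (Fin (n + 1) → ℝ) :=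
  convexHull ℝ ((fun i => Pi.single i (1 : ℝ)) '' (S : Set (Fin (n + 1))))

open scoped Pointwise in
/-- The nestohedron `P_B`: the Minkowski sum of the simplices `Δ^S`, `S ∈ B`. -/
noncomputable def nestohedron {n : ℕ} (B : Finset (Finset (Fin (n + 1)))) :
    Set (Fin (n + 1) → ℝ) :=
  ∑ S ∈ B, simplex S

/-- The face `F_S` of `P_B` corresponding to `S`: the points of `P_B` at which
`∑ i ∈ S, x i` attains its minimum over `P_B`. -/
def nestFace {n : ℕ} (B : Finset (Finset (Fin (n + 1)))) (S : Finset (Fin (n + 1))) :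
    Set (Fin (n + 1) → ℝ) :=
  {x ∈ nestohedron B | ∀ y ∈ nestohedron B, ∑ i ∈ S, x i ≤ ∑ i ∈ S, y i}

theorem nestFace_isExposed {n : ℕ} (B : Finset (Finset (Fin (n + 1))))
    (S : Finset (Fin (n + 1))) : IsExposed ℝ (nestohedron B) (nestFace B S) := by
  intro _
  refine ⟨-∑ i ∈ S, ContinuousLinearMap.proj (R := ℝ) (φ := fun _ : Fin (n + 1) => ℝ) i, ?_⟩
  ext x
  simp [nestFace]

/-- `D` is a representation of `S` as a disjoint union of elements of `B`. -/
def IsDisjointRep {n : ℕ} (B : Finset (Finset (Fin (n + 1)))) (S : Finset (Fin (n + 1)))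
    (D : Finset (Finset (Fin (n + 1)))) : Prop :=
  D ⊆ B ∧ (∀ X ∈ D, ∀ Y ∈ D, X ≠ Y → Disjoint X Y) ∧ D.sup id = S

/-- `D` is the decomposition of `S` by elements of `B`: a representation of `S` as a disjoint union
of elements of `B` with the least possible number of parts. -/
def IsDecomposition {n : ℕ} (B : Finset (Finset (Fin (n + 1)))) (S : Finset (Fin (n + 1)))
    (D : Finset (Finset (Fin (n + 1)))) : Prop :=
  IsDisjointRep B S D ∧ ∀ D', IsDisjointRep B S D' → D.card ≤ D'.card

/-! ### The realization of a flag nestohedron obtained by shaving the cube -/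

/-- The standard cube `[-1, 1]ⁿ`, given by the inequalities `± x_i ≤ 1`. -/
def cube (n : ℕ) : Set (Fin n → ℝ) := Set.Icc (-1) 1

/-- The normals of the facets of the standard cube: the vectors `± e_i`. -/
def cubeNormals (n : ℕ) : Set (Fin n → ℤ) :=
  {w | ∃ i, w = Pi.single i 1 ∨ w = -Pi.single i 1}

/-- `P_{B₀}` is combinatorially equivalent to the cube, and `l` is the resulting identification of
the elements `S ≠ {0, …, n}` of `B₀` with the normals `± e_i` of the facets of the cube: an
isomorphism of face lattices carries `F_S` to the facet of the cube with outer normal `l S`. -/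
def IsCubeIdentification {n : ℕ} (B₀ : Finset (Finset (Fin (n + 1))))
    (l : Finset (Fin (n + 1)) → Fin n → ℤ) : Prop :=
  Set.BijOn l {S | S ∈ B₀ ∧ S ≠ Finset.univ} (cubeNormals n) ∧
  ∃ φ : Face (nestohedron B₀) ≃o Face (cube n), ∀ S ∈ B₀, S ≠ Finset.univ →
    (φ ⟨nestFace B₀ S, nestFace_isExposed B₀ S⟩ : Set (Fin n → ℝ)) =
      {x ∈ cube n | pairing (l S) x = 1}

/-- All the choices made in realizing the nestohedron `P_B` by shavings of the cube, and the
resulting inequalities `l_S x ≤ b_S`, `S ∈ B`, `S ≠ {0, …, n}`. -/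
structure CubeShaving {n : ℕ} (B : Finset (Finset (Fin (n + 1)))) where
  /-- the length of the chain `B_0 ⊂ B_1 ⊂ ⋯ ⊂ B_N = B` of building sets -/
  N : ℕ
  /-- the chain; its values beyond `N` are irrelevant -/
  chain : ℕ → Finset (Finset (Fin (n + 1)))
  chain_zero_isBuildingSet : IsBuildingSet (chain 0)
  univ_mem_chain_zero : Finset.univ ∈ chain 0
  chain_zero_subset : chain 0 ⊆ B
  chain_last : chain N = B
  /-- the set that is added to `B_i` in order to generate `B_{i+1}` -/
  gen : ℕ → Finset (Fin (n + 1))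
  gen_minimal : ∀ i < N, Minimal (fun S => S ∈ B ∧ S ∉ chain i) (gen i)
  chain_succ : ∀ i < N, IsClosureOf (insert (gen i) (chain i)) (chain (i + 1))
  /-- the number of elements of `B` outside `B_0` -/
  M : ℕ
  /-- the numbering of the elements of `B` outside `B_0` -/
  T : Fin M → Finset (Fin (n + 1))
  T_injective : Function.Injective T
  T_range : ∀ S, (∃ j, T j = S) ↔ S ∈ B ∧ S ∉ chain 0
  /-- elements of `B_i` come before the elements outside `B_i` -/
  T_chain : ∀ i ≤ N, ∀ j k, T j ∈ chain i → T k ∉ chain i → j < k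
  /-- inside each `B_{i+1} \ B_i` the numbering reverses inclusion -/
  T_reverse : ∀ i < N, ∀ j k, T j ∈ chain (i + 1) → T j ∉ chain i →
    T k ∈ chain (i + 1) → T k ∉ chain i → T j ⊂ T k → k < j
  /-- the normals `l_S` -/
  l : Finset (Fin (n + 1)) → Fin n → ℤ
  /-- the right-hand sides `b_S` -/
  b : Finset (Fin (n + 1)) → ℝ
  /-- the numbers `ε_j` -/
  ε : Fin M → ℝ
  l_cube : IsCubeIdentification (chain 0) l
  b_cube : ∀ S ∈ chain 0, S ≠ Finset.univ → b S = 1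
  l_rec : ∀ i < N, ∀ j, T j ∈ chain (i + 1) → T j ∉ chain i → ∀ S₁ S₂, S₁ ≠ S₂ →
    IsDecomposition (chain i) (T j) {S₁, S₂} → l (T j) = l S₁ + l S₂
  b_rec : ∀ i < N, ∀ j, T j ∈ chain (i + 1) → T j ∉ chain i → ∀ S₁ S₂, S₁ ≠ S₂ →
    IsDecomposition (chain i) (T j) {S₁, S₂} → b (T j) = b S₁ + b S₂ - ε j
  ε_pos : ∀ j, 0 < ε j
  /-- `ε_j` is small enough: the `j`-th inequality shaves off the face `F_{S₁} ∩ F_{S₂}` of the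
  polytope given by the preceding inequalities, that is, every vertex of that polytope which is not
  on this face satisfies the `j`-th inequality strictly. -/
  ε_small : ∀ i < N, ∀ j, T j ∈ chain (i + 1) → T j ∉ chain i → ∀ S₁ S₂, S₁ ≠ S₂ →
    IsDecomposition (chain i) (T j) {S₁, S₂} →
    ∀ v ∈ Set.extremePoints ℝ {x : Fin n → ℝ |
        (∀ S ∈ chain 0, S ≠ Finset.univ → pairing (l S) x ≤ b S) ∧
        ∀ k < j, pairing (l (T k)) x ≤ b (T k)},
      ¬ (pairing (l S₁) v = b S₁ ∧ pairing (l S₂) v = b S₂) → pairing (l (T j)) v < b (T j)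

/-- The polytope in `ℝⁿ` given by all the inequalities `l_S x ≤ b_S`, `S ∈ B`, `S ≠ {0, …, n}`. -/
def CubeShaving.polytope {n : ℕ} {B : Finset (Finset (Fin (n + 1)))} (R : CubeShaving B) :
    Set (Fin n → ℝ) :=
  {x | ∀ S ∈ B, S ≠ Finset.univ → pairing (R.l S) x ≤ R.b S}

end Nesto

/-! Each new inequality truncates a simple unimodular polytope along the intersection of two facets,
by a hyperplane whose normal is the sum of the two normals; such a truncation is a blow-up and keeps
every vertex unimodular. The proof is an induction on the number of shavings, starting from the
cube.

The induction carries the predicate `IsUnimodular`: bounded, with interior points, and such that at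
each vertex the tight normals have an integer dual family. Dual vectors are easier to transport than
bases. Let a vertex `v` lie on the new facet. It is not a vertex of the old polytope, so it lies on
an old edge, which leads to an old vertex `w` on both facets of the shaved face. One of the two
normals, `l_m`, is no longer tight at `v`; call the other `l_p`. Replacing `l_m` by `l_m + l_p`
turns the dual pair `u_m, u_p` into `u_m, u_p - u_m`, again integral (`IsUnimodular.insert`).

The recursion needs each added set to split into exactly two sets already present. For the generator
of a step this is where flagness enters. Take a smallest nontrivial partition of `S` into elements
of `B`. No two parts have their union in `B` if there are more than two of them, so their facets
meet pairwise; yet partition facets of an element of `B` never have a common point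
(`exists_disjoint_union_of_isFlag`). The other sets of the step come from an explicit form of the
closure (`exists_disjoint_union_of_closure`).

Finally, a dual family gives a lattice basis and identifies the tight inequalities at a vertex with
the facets through it, which is the Delzant property. -/

namespace Nesto

open Finset

/-! ### Facets of the nestohedron and their intersections -/

section Nestohedron

variable {n : ℕ} {B : Finset (Finset (Fin (n + 1)))}

/-- The linear function `x ↦ ∑ i ∈ S, x i`. -/
def sumOn {n : ℕ} (S : Finset (Fin (n + 1))) : (Fin (n + 1) → ℝ) →ₗ[ℝ] ℝ :=
  ∑ i ∈ S, LinearMap.proj i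

theorem sumOn_apply (S : Finset (Fin (n + 1))) (x : Fin (n + 1) → ℝ) :
    sumOn S x = ∑ i ∈ S, x i := by
  simp [sumOn]

theorem sumOn_single (S : Finset (Fin (n + 1))) (i : Fin (n + 1)) (r : ℝ) :
    sumOn S (Pi.single i r) = if i ∈ S then r else 0 := by
  simp [sumOn_apply]

theorem le_sumOn_of_mem_simplex (S T : Finset (Fin (n + 1))) {x : Fin (n + 1) → ℝ}
    (hx : x ∈ simplex T) : (if T ⊆ S then (1 : ℝ) else 0) ≤ sumOn S x := by
  have hc : Convex ℝ {x | (if T ⊆ S then (1 : ℝ) else 0) ≤ sumOn S x} :=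
    convex_halfSpace_ge (sumOn S).isLinear _
  refine convexHull_min ?_ hc hx
  rintro _ ⟨i, hi, rfl⟩
  simp only [Set.mem_ofPred_eq, sumOn_single]
  split_ifs with h₁ h₂ h₂
  · exact le_rfl
  · exact absurd (h₁ hi) h₂
  · exact zero_le_one
  · exact le_rfl

theorem sumOn_univ_of_mem_simplex (T : Finset (Fin (n + 1))) {x : Fin (n + 1) → ℝ}
    (hx : x ∈ simplex T) : sumOn univ x = 1 := by
  have hc : Convex ℝ {x : Fin (n + 1) → ℝ | sumOn univ x = 1} :=
    convex_hyperplane (sumOn univ).isLinear _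
  refine convexHull_min ?_ hc hx
  rintro _ ⟨i, hi, rfl⟩
  simp [sumOn_single]

theorem card_le_sumOn (S : Finset (Fin (n + 1))) {x : Fin (n + 1) → ℝ}
    (hx : x ∈ nestohedron B) : ((#{T ∈ B | T ⊆ S} : ℕ) : ℝ) ≤ sumOn S x := by
  obtain ⟨g, hg, rfl⟩ := (Set.mem_finsetSum _ _ _).1 hx
  rw [map_sum, Finset.card_filter, Nat.cast_sum]
  refine Finset.sum_le_sum fun T hT => ?_
  simpa using le_sumOn_of_mem_simplex S T (hg hT)

theorem sumOn_univ_of_mem {x : Fin (n + 1) → ℝ} (hx : x ∈ nestohedron B) :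
    sumOn univ x = #B := by
  obtain ⟨g, hg, rfl⟩ := (Set.mem_finsetSum _ _ _).1 hx
  rw [map_sum, Finset.sum_congr rfl fun T hT => sumOn_univ_of_mem_simplex T (hg hT)]
  simp

/-- The point of the nestohedron obtained by choosing a vertex of each simplex. -/
def vertexPoint (B : Finset (Finset (Fin (n + 1)))) (f : Finset (Fin (n + 1)) → Fin (n + 1)) :
    Fin (n + 1) → ℝ :=
  ∑ T ∈ B, Pi.single (f T) 1

theorem vertexPoint_mem {f : Finset (Fin (n + 1)) → Fin (n + 1)} (hf : ∀ T ∈ B, f T ∈ T) :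
    vertexPoint B f ∈ nestohedron B :=
  Set.finsetSum_mem_finsetSum _ _ _ fun T hT => subset_convexHull ℝ _ ⟨f T, hf T hT, rfl⟩

theorem sumOn_vertexPoint (S : Finset (Fin (n + 1))) {f : Finset (Fin (n + 1)) → Fin (n + 1)}
    (hf : ∀ T ∈ B, f T ∈ T) (hS : ∀ T ∈ B, f T ∈ S → T ⊆ S) :
    sumOn S (vertexPoint B f) = #{T ∈ B | T ⊆ S} := by
  rw [vertexPoint, map_sum, Finset.card_filter, Nat.cast_sum]
  refine Finset.sum_congr rfl fun T hT => ?_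
  rw [sumOn_single]
  by_cases h : T ⊆ S
  · simp [h, h (hf T hT)]
  · simp [h, mt (hS T hT) h]

/-- Choosing in each `T ∈ B` an element outside `S`, if possible. -/
theorem exists_choice_outside (hB : IsBuildingSet B) (S : Finset (Fin (n + 1))) :
    ∃ f : Finset (Fin (n + 1)) → Fin (n + 1),
      (∀ T ∈ B, f T ∈ T) ∧ ∀ T ∈ B, f T ∈ S → T ⊆ S := by
  have h : ∀ T, ∃ i, T ∈ B → i ∈ T ∧ (i ∈ S → T ⊆ S) := by
    intro T
    by_cases hT : T ∈ B
    · by_cases hTS : T ⊆ S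
      · obtain ⟨i, hi⟩ := hB.nonempty_of_mem T hT
        exact ⟨i, fun _ => ⟨hi, fun _ => hTS⟩⟩
      · obtain ⟨i, hi, hiS⟩ := Finset.not_subset.1 hTS
        exact ⟨i, fun _ => ⟨hi, fun h => absurd h hiS⟩⟩
    · exact ⟨0, fun h => absurd h hT⟩
  choose f hf using h
  exact ⟨f, fun T hT => (hf T hT).1, fun T hT => (hf T hT).2⟩

/-- The minimum is the number of elements of `B` inside `S`: a summand contributes at least 1 if it
lies in `S` and at least 0 otherwise, and choosing vertices outside `S` whenever possible attains
all these bounds at once. -/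
theorem mem_nestFace_iff (hB : IsBuildingSet B) {S : Finset (Fin (n + 1))}
    {x : Fin (n + 1) → ℝ} :
    x ∈ nestFace B S ↔ x ∈ nestohedron B ∧ sumOn S x = #{T ∈ B | T ⊆ S} := by
  constructor
  · rintro ⟨hx, hmin⟩
    refine ⟨hx, le_antisymm ?_ (card_le_sumOn S hx)⟩
    obtain ⟨f, hf, hfS⟩ := exists_choice_outside hB S
    rw [← sumOn_vertexPoint S hf hfS]
    simpa only [sumOn_apply] using hmin _ (vertexPoint_mem hf)
  · rintro ⟨hx, hS⟩
    refine ⟨hx, fun y hy => ?_⟩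
    have := card_le_sumOn S hy
    rw [← hS] at this
    simpa only [sumOn_apply] using this

theorem vertexPoint_mem_nestFace (hB : IsBuildingSet B) {S : Finset (Fin (n + 1))}
    {f : Finset (Fin (n + 1)) → Fin (n + 1)} (hf : ∀ T ∈ B, f T ∈ T)
    (hS : ∀ T ∈ B, f T ∈ S → T ⊆ S) : vertexPoint B f ∈ nestFace B S :=
  (mem_nestFace_iff hB).2 ⟨vertexPoint_mem hf, sumOn_vertexPoint S hf hS⟩

theorem vertexPoint_update_sub {T : Finset (Fin (n + 1))} (hT : T ∈ B)
    (f : Finset (Fin (n + 1)) → Fin (n + 1)) (i j : Fin (n + 1)) :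
    vertexPoint B (Function.update f T i) - vertexPoint B (Function.update f T j) =
      Pi.single i 1 - Pi.single j 1 := by
  rw [vertexPoint, vertexPoint, ← Finset.sum_sub_distrib, Finset.sum_eq_single_of_mem T hT]
  · simp
  · intro U _ hU
    simp [Function.update_of_ne hU]

theorem nestFace_nonempty (hB : IsBuildingSet B) (S : Finset (Fin (n + 1))) :
    (nestFace B S).Nonempty := by
  obtain ⟨f, hf, hfS⟩ := exists_choice_outside hB S
  exact ⟨_, vertexPoint_mem_nestFace hB hf hfS⟩

/-- Start from a minimizing choice of vertices and change only the vertex chosen in `T`: both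
resulting points still minimize. -/
theorem single_sub_single_mem_vectorSpan_nestFace (hB : IsBuildingSet B)
    {S T : Finset (Fin (n + 1))} (hT : T ∈ B) {i j : Fin (n + 1)} (hi : i ∈ T) (hj : j ∈ T)
    (hiS : i ∈ S → T ⊆ S) (hjS : j ∈ S → T ⊆ S) :
    Pi.single i 1 - Pi.single j 1 ∈ vectorSpan ℝ (nestFace B S) := by
  obtain ⟨f, hf, hfS⟩ := exists_choice_outside hB S
  have key : ∀ k ∈ T, (k ∈ S → T ⊆ S) →
      vertexPoint B (Function.update f T k) ∈ nestFace B S := by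
    intro k hk hkS
    refine vertexPoint_mem_nestFace hB ?_ ?_ <;> intro U hU <;>
      by_cases h : U = T <;> [subst h; skip; subst h; skip] <;>
      simp_all [Function.update_of_ne]
  rw [← vertexPoint_update_sub hT f i j]
  exact vsub_mem_vectorSpan ℝ (key i hi hiS) (key j hj hjS)

theorem sum_smul_single_sub_eq (S : Finset (Fin (n + 1))) (s : Fin (n + 1))
    {u : Fin (n + 1) → ℝ} (hu : sumOn S u = 0) :
    ∑ i ∈ S, u i • (Pi.single i 1 - Pi.single s 1 : Fin (n + 1) → ℝ) =
      ∑ i ∈ S, Pi.single i (u i) := by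
  simp only [smul_sub, Finset.sum_sub_distrib, ← Finset.sum_smul, ← sumOn_apply, hu, zero_smul,
    sub_zero]
  exact Finset.sum_congr rfl fun i _ => by rw [← Pi.single_smul]; simp

theorem finrank_inf_ker_add_one {V : Type*} [AddCommGroup V] [Module ℝ V] [FiniteDimensional ℝ V]
    (W : Submodule ℝ V) (φ : V →ₗ[ℝ] ℝ) {x : V} (hx : x ∈ W) (hφ : φ x ≠ 0) :
    Module.finrank ℝ (W ⊓ LinearMap.ker φ : Submodule ℝ V) + 1 = Module.finrank ℝ W := by
  have hs : Function.Surjective (φ.domRestrict W) := by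
    apply LinearMap.surjective
    intro h
    exact hφ (by simpa using LinearMap.congr_fun h ⟨x, hx⟩)
  have h₁ := (φ.domRestrict W).finrank_range_add_finrank_ker
  rw [LinearMap.range_eq_top.2 hs, finrank_top, Module.finrank_self] at h₁
  have h₂ : (LinearMap.ker (φ.domRestrict W)).map W.subtype = W ⊓ LinearMap.ker φ := by
    ext y
    simp [and_comm]
  rw [← h₂, Submodule.finrank_map_subtype_eq]
  omega

theorem nestFace_isFacet (hB : IsBuildingSet B) (hconn : univ ∈ B) {S : Finset (Fin (n + 1))}
    (hS : S ∈ B) (hSu : S ≠ univ) : IsFacet (nestohedron B) (nestFace B S) := by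
  refine ⟨nestFace_isExposed B S, nestFace_nonempty hB S, ?_⟩
  obtain ⟨s, hs⟩ := hB.nonempty_of_mem S hS
  obtain ⟨t, ht⟩ : ∃ t, t ∉ S := by
    by_contra! h
    exact hSu (Finset.eq_univ_iff_forall.2 h)
  have hst : (Pi.single s 1 - Pi.single t 1 : Fin (n + 1) → ℝ) ∈
      vectorSpan ℝ (nestohedron B) := by
    obtain ⟨f, hf, -⟩ := exists_choice_outside hB S
    rw [← vertexPoint_update_sub hconn f s t]
    refine vsub_mem_vectorSpan ℝ (vertexPoint_mem ?_) (vertexPoint_mem ?_) <;> intro U hU <;>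
      by_cases h : U = univ <;> [subst h; skip; subst h; skip] <;> simp_all
  have hspan : vectorSpan ℝ (nestFace B S) =
      vectorSpan ℝ (nestohedron B) ⊓ LinearMap.ker (sumOn S) := by
    apply le_antisymm
    · refine le_inf (vectorSpan_mono ℝ fun x hx => hx.1) ?_
      refine Submodule.span_le.2 ?_
      rintro _ ⟨x, hx, y, hy, rfl⟩
      simp [((mem_nestFace_iff hB).1 hx).2, ((mem_nestFace_iff hB).1 hy).2]
    · rintro u ⟨hu, huS⟩
      have huS : sumOn S u = 0 := huS
      have hu : sumOn univ u = 0 := by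
        have : vectorSpan ℝ (nestohedron B) ≤ LinearMap.ker (sumOn univ) := by
          refine Submodule.span_le.2 ?_
          rintro _ ⟨x, hx, y, hy, rfl⟩
          simp [sumOn_univ_of_mem hx, sumOn_univ_of_mem hy]
        exact this hu
      have hSc : sumOn Sᶜ u = 0 := by
        rw [sumOn_apply] at *
        have := Finset.sum_add_sum_compl S u
        linarith
      -- A vector with zero sum on `S` and on its complement is spanned by differences inside each
      -- block. The first kind is realized by moving the vertex chosen in `S`, the second by moving
      -- the one chosen in the full set.
      have hdec : u = ∑ i ∈ S, u i • (Pi.single i 1 - Pi.single s 1 : Fin (n + 1) → ℝ) +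
          ∑ i ∈ Sᶜ, u i • (Pi.single i 1 - Pi.single t 1 : Fin (n + 1) → ℝ) := by
        rw [sum_smul_single_sub_eq S s huS, sum_smul_single_sub_eq Sᶜ t hSc,
          Finset.sum_add_sum_compl, Finset.univ_sum_single]
      rw [hdec]
      refine Submodule.add_mem _ (Submodule.sum_mem _ fun i hi => Submodule.smul_mem _ _ ?_)
        (Submodule.sum_mem _ fun i hi => Submodule.smul_mem _ _ ?_)
      · exact single_sub_single_mem_vectorSpan_nestFace hB hS hi hs
          (fun _ => subset_rfl) (fun _ => subset_rfl)
      · exact single_sub_single_mem_vectorSpan_nestFace hB hconn (mem_univ _) (mem_univ _)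
          (fun h => absurd h (by simpa using hi)) (fun h => absurd h ht)
  rw [affDim, affDim, hspan]
  refine finrank_inf_ker_add_one _ _ hst ?_
  simp [sumOn_single, hs, ht]

/-- An element of `B` inside `S ∪ T` that met both sets without lying in either would glue them into
an element of `B`. Hence a choice of vertices avoiding `S ∪ T` where possible is optimal for both
sets. -/
theorem nestFace_inter_nonempty (hB : IsBuildingSet B) {S T : Finset (Fin (n + 1))}
    (hS : S ∈ B) (hT : T ∈ B) (hST : Disjoint S T) (hU : S ∪ T ∉ B) :
    (nestFace B S ∩ nestFace B T).Nonempty := by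
  obtain ⟨f, hf, hfU⟩ := exists_choice_outside hB (S ∪ T)
  have key : ∀ U ∈ B, U ⊆ S ∪ T → U ⊆ S ∨ U ⊆ T := by
    intro U hUB hUST
    by_contra! h
    obtain ⟨i, hi, hiS⟩ := Finset.not_subset.1 h.1
    obtain ⟨j, hj, hjT⟩ := Finset.not_subset.1 h.2
    have hiT : i ∈ T := (Finset.mem_union.1 (hUST hi)).resolve_left hiS
    have hjS : j ∈ S := (Finset.mem_union.1 (hUST hj)).resolve_right hjT
    have h₁ := hB.union_mem S hS U hUB ⟨j, Finset.mem_inter.2 ⟨hjS, hj⟩⟩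
    have h₂ := hB.union_mem _ h₁ T hT
      ⟨i, Finset.mem_inter.2 ⟨Finset.mem_union_right _ hi, hiT⟩⟩
    refine hU ?_
    convert h₂ using 1
    ext k
    have := @hUST k
    simp only [Finset.mem_union] at *
    tauto
  refine ⟨vertexPoint B f, vertexPoint_mem_nestFace hB hf ?_, vertexPoint_mem_nestFace hB hf ?_⟩
  · intro U hUB hfS
    rcases key U hUB (hfU U hUB (Finset.mem_union_left _ hfS)) with h | h
    · exact h
    · exact absurd (h (hf U hUB)) (Finset.disjoint_left.1 hST hfS)
  · intro U hUB hfT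
    rcases key U hUB (hfU U hUB (Finset.mem_union_right _ hfT)) with h | h
    · exact absurd hfT (Finset.disjoint_left.1 hST (h (hf U hUB)))
    · exact h

/-- At a common point the coordinate sum over `S` would equal the number of elements of `B` lying
inside the parts. The lower bound for `S` also counts `S` itself, which lies in no part. -/
theorem sInter_nestFace_eq_empty (hB : IsBuildingSet B) {S : Finset (Fin (n + 1))} (hS : S ∈ B)
    {D : Finset (Finset (Fin (n + 1)))} (hD : IsDisjointRep B S D) (hSD : S ∉ D) :
    ¬ (⋂₀ (nestFace B '' (D : Set (Finset (Fin (n + 1)))))).Nonempty := by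
  rintro ⟨x, hx⟩
  obtain ⟨hDB, hdisj, hsup⟩ := hD
  have hface : ∀ X ∈ D, x ∈ nestFace B X := fun X hX => hx _ ⟨X, hX, rfl⟩
  have hpw : (D : Set (Finset (Fin (n + 1)))).PairwiseDisjoint id :=
    fun X hX Y hY h => hdisj X hX Y hY h
  have hne : D.Nonempty := by
    rw [Finset.nonempty_iff_ne_empty]
    rintro rfl
    exact (hB.nonempty_of_mem S hS).ne_empty hsup.symm
  obtain ⟨X₀, hX₀⟩ := hne
  have hlow := card_le_sumOn S (hface X₀ hX₀).1
  have hsum : sumOn S x = ∑ X ∈ D, sumOn X x := by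
    rw [← hsup, Finset.sup_eq_biUnion]
    simp only [sumOn_apply]
    exact Finset.sum_biUnion hpw
  rw [hsum, Finset.sum_congr rfl fun X hX => ((mem_nestFace_iff hB).1 (hface X hX)).2,
    ← Nat.cast_sum, Nat.cast_le, ← Finset.card_biUnion] at hlow
  · refine absurd hlow (not_le.2 (Finset.card_lt_card ⟨?_, fun h => ?_⟩))
    · intro U hU
      simp only [Finset.mem_biUnion, Finset.mem_filter] at hU ⊢
      obtain ⟨X, hX, hUB, hUX⟩ := hU
      exact ⟨hUB, hUX.trans (hsup ▸ Finset.le_sup (f := id) hX)⟩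
    · obtain ⟨X, hX, hSX⟩ := Finset.mem_biUnion.1
        (h (Finset.mem_filter.2 ⟨hS, subset_rfl⟩))
      have hXS : X ⊆ S := hsup ▸ Finset.le_sup (f := id) hX
      exact hSD (((Finset.mem_filter.1 hSX).2.antisymm hXS) ▸ hX)
  · intro X hX Y hY hXY
    refine Finset.disjoint_left.2 ?_
    intro U hUX hUY
    obtain ⟨i, hi⟩ := hB.nonempty_of_mem U (Finset.mem_filter.1 hUX).1
    exact Finset.disjoint_left.1 (hdisj X hX Y hY hXY) ((Finset.mem_filter.1 hUX).2 hi)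
      ((Finset.mem_filter.1 hUY).2 hi)

end Nestohedron

/-! ### Splitting elements of a flag building set into two parts -/

section Combinatorics

variable {n : ℕ} {B : Finset (Finset (Fin (n + 1)))}

theorem exists_isDisjointRep_singletons (hB : IsBuildingSet B) (S : Finset (Fin (n + 1))) :
    IsDisjointRep B S (S.image fun i => {i}) := by
  refine ⟨?_, ?_, ?_⟩
  · intro X hX
    obtain ⟨i, -, rfl⟩ := Finset.mem_image.1 hX
    exact hB.singleton_mem i
  · intro X hX Y hY h
    obtain ⟨i, -, rfl⟩ := Finset.mem_image.1 hX
    obtain ⟨j, -, rfl⟩ := Finset.mem_image.1 hY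
    exact Finset.disjoint_singleton.2 fun hij => h (by rw [hij])
  · ext i
    simp [Finset.sup_eq_biUnion]

/-- Two parts of a representation can be merged when their union is in `B`. -/
theorem IsDisjointRep.merge {S : Finset (Fin (n + 1))} {D : Finset (Finset (Fin (n + 1)))}
    (hD : IsDisjointRep B S D) {X Y : Finset (Fin (n + 1))} (hX : X ∈ D) (hY : Y ∈ D)
    (hXY : X ∪ Y ∈ B) : IsDisjointRep B S (insert (X ∪ Y) ((D.erase X).erase Y)) := by
  obtain ⟨hDB, hdisj, hsup⟩ := hD
  have hout : ∀ Z ∈ (D.erase X).erase Y, Disjoint (X ∪ Y) Z := by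
    intro Z hZ
    simp only [Finset.mem_erase] at hZ
    exact Finset.disjoint_union_left.2
      ⟨hdisj X hX Z hZ.2.2 (Ne.symm hZ.2.1), hdisj Y hY Z hZ.2.2 (Ne.symm hZ.1)⟩
  refine ⟨?_, ?_, ?_⟩
  · intro Z hZ
    rcases Finset.mem_insert.1 hZ with rfl | hZ
    · exact hXY
    · exact hDB (Finset.mem_of_mem_erase (Finset.mem_of_mem_erase hZ))
  · intro Z hZ W hW h
    rcases Finset.mem_insert.1 hZ with rfl | hZ <;> rcases Finset.mem_insert.1 hW with rfl | hW
    · exact absurd rfl h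
    · exact hout W hW
    · exact (hout Z hZ).symm
    · exact hdisj Z (Finset.mem_of_mem_erase (Finset.mem_of_mem_erase hZ)) W
        (Finset.mem_of_mem_erase (Finset.mem_of_mem_erase hW)) h
  · rw [← hsup]
    apply le_antisymm
    · refine Finset.sup_le fun Z hZ => ?_
      rcases Finset.mem_insert.1 hZ with rfl | hZ
      · exact Finset.union_subset (Finset.le_sup (f := id) hX) (Finset.le_sup (f := id) hY)
      · exact Finset.le_sup (f := id) (Finset.mem_of_mem_erase (Finset.mem_of_mem_erase hZ))
    · refine Finset.sup_le fun Z hZ => ?_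
      have hle := Finset.le_sup (f := id)
        (Finset.mem_insert_self (X ∪ Y) ((D.erase X).erase Y))
      by_cases hZX : Z = X
      · subst hZX
        exact Finset.subset_union_left.trans hle
      by_cases hZY : Z = Y
      · subst hZY
        exact Finset.subset_union_right.trans hle
      · exact Finset.le_sup (f := id) (Finset.mem_insert_of_mem
          (Finset.mem_erase.2 ⟨hZY, Finset.mem_erase.2 ⟨hZX, hZ⟩⟩))

/-- In the building set of a flag nestohedron every element that is not a singleton is the
disjoint union of two others. -/
theorem exists_disjoint_union_of_isFlag (hB : IsBuildingSet B) (hconn : univ ∈ B)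
    (hflag : IsFlag (nestohedron B)) {S : Finset (Fin (n + 1))} (hS : S ∈ B) (hSu : S ≠ univ)
    (hSs : ∀ i, S ≠ {i}) : ∃ X ∈ B, ∃ Y ∈ B, Disjoint X Y ∧ X ∪ Y = S := by
  classical
  have hex : ∃ D, IsDisjointRep B S D ∧ S ∉ D := by
    refine ⟨_, exists_isDisjointRep_singletons hB S, fun h => ?_⟩
    obtain ⟨i, -, hi⟩ := Finset.mem_image.1 h
    exact hSs i hi.symm
  obtain ⟨D, ⟨hD, hSD⟩, hmin⟩ :=
    WellFounded.has_min (measure fun D : Finset (Finset (Fin (n + 1))) => #D).wf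
      {D | IsDisjointRep B S D ∧ S ∉ D} hex
  have hmin : ∀ D', IsDisjointRep B S D' → S ∉ D' → #D ≤ #D' :=
    fun D' h₁ h₂ => not_lt.1 (hmin D' ⟨h₁, h₂⟩)
  obtain ⟨hDB, hdisj, hsup⟩ := hD
  have hSne := hB.nonempty_of_mem S hS
  have hsub : ∀ X ∈ D, X ⊆ S := fun X hX => hsup ▸ Finset.le_sup (f := id) hX
  by_cases hcard : #D ≤ 2
  · have h2 : #D = 2 := by
      have h0 : #D ≠ 0 := by
        intro h
        rw [Finset.card_eq_zero] at h
        subst h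
        exact hSne.ne_empty hsup.symm
      have h1 : #D ≠ 1 := by
        intro h
        obtain ⟨X, rfl⟩ := Finset.card_eq_one.1 h
        simp at hsup hSD
        exact hSD hsup.symm
      omega
    obtain ⟨X, Y, hXY, rfl⟩ := Finset.card_eq_two.1 h2
    refine ⟨X, hDB (by simp), Y, hDB (by simp), hdisj X (by simp) Y (by simp) hXY, ?_⟩
    simpa using hsup
  · exfalso
    push Not at hcard
    -- With at least three parts, flagness would yield a common point of their facets. They meet
    -- pairwise because two parts with union in `B` could be merged into a smaller representation.
    refine sInter_nestFace_eq_empty hB hS ⟨hDB, hdisj, hsup⟩ hSD (hflag _ ?_ ?_)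
    · rintro _ ⟨X, hX, rfl⟩
      exact nestFace_isFacet hB hconn (hDB hX) fun h =>
        hSu (Finset.univ_subset_iff.1 (h ▸ hsub X hX))
    · rintro _ ⟨X, hX, rfl⟩ _ ⟨Y, hY, rfl⟩
      by_cases hXY : X = Y
      · subst hXY
        simpa using nestFace_nonempty hB X
      refine nestFace_inter_nonempty hB (hDB hX) (hDB hY) (hdisj X hX Y hY hXY) fun hU => ?_
      have hYX : Y ∈ D.erase X := Finset.mem_erase.2 ⟨Ne.symm hXY, hY⟩
      have hc₁ := Finset.card_erase_add_one hX
      have hc₂ := Finset.card_erase_add_one hYX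
      have hc₃ := Finset.card_insert_le (X ∪ Y) ((D.erase X).erase Y)
      have := hmin _ (IsDisjointRep.merge ⟨hDB, hdisj, hsup⟩ hX hY hU) ?_
      · omega
      · intro h
        rcases Finset.mem_insert.1 h with h | h
        -- Merging does not produce `S` itself, since a third part remains outside `X ∪ Y`.
        · obtain ⟨Z, hZ⟩ : ((D.erase X).erase Y).Nonempty := by
            rw [← Finset.card_pos]
            omega
          simp only [Finset.mem_erase] at hZ
          obtain ⟨i, hi⟩ := hB.nonempty_of_mem Z (hDB hZ.2.2)
          have hiS := hsub Z hZ.2.2 hi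
          rw [h] at hiS
          rcases Finset.mem_union.1 hiS with hiX | hiY
          · exact Finset.disjoint_left.1 (hdisj Z hZ.2.2 X hX hZ.2.1) hi hiX
          · exact Finset.disjoint_left.1 (hdisj Z hZ.2.2 Y hY hZ.1) hi hiY
        · exact hSD (Finset.mem_of_mem_erase (Finset.mem_of_mem_erase h))

/-- The elements added to a building set when it is enlarged by a disjoint union of two of its
elements are themselves disjoint unions of two of its elements. -/
theorem exists_disjoint_union_of_closure {C : Finset (Finset (Fin (n + 1)))} (hB : IsBuildingSet B)
    {X Y : Finset (Fin (n + 1))} (hX : X ∈ B) (hY : Y ∈ B)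
    (hC : IsClosureOf (insert (X ∪ Y) B) C) {U : Finset (Fin (n + 1))} (hU : U ∈ C)
    (hUB : U ∉ B) : ∃ S ∈ B, ∃ T ∈ B, Disjoint S T ∧ S ∪ T = U := by
  classical
  have hXne := hB.nonempty_of_mem X hX
  have hYne := hB.nonempty_of_mem Y hY
  -- Candidate for the closure. The conditions `X ⊆ S` and `Y ⊆ T` make it stable: two new sets
  -- overlap in both `X` and `Y`, so their halves can be joined separately.
  let A : Finset (Finset (Fin (n + 1))) :=
    {U | U ∈ B ∨ ∃ S ∈ B, ∃ T ∈ B, X ⊆ S ∧ Y ⊆ T ∧ S ∪ T = U}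
  have hA : ∀ U, U ∈ A ↔ U ∈ B ∨ ∃ S ∈ B, ∃ T ∈ B, X ⊆ S ∧ Y ⊆ T ∧ S ∪ T = U := by simp [A]
  have hmix : ∀ V ∈ B, ∀ S ∈ B, ∀ T ∈ B, X ⊆ S → Y ⊆ T → (V ∩ (S ∪ T)).Nonempty →
      V ∪ (S ∪ T) ∈ A := by
    intro V hV S hS T hT hXS hYT hne
    rw [hA]
    right
    obtain ⟨i, hi⟩ := hne
    obtain ⟨hiV, hi⟩ := Finset.mem_inter.1 hi
    rcases Finset.mem_union.1 hi with h | h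
    · exact ⟨V ∪ S, hB.union_mem V hV S hS ⟨i, Finset.mem_inter.2 ⟨hiV, h⟩⟩, T, hT,
        hXS.trans Finset.subset_union_right, hYT, Finset.union_assoc _ _ _⟩
    · exact ⟨S, hS, V ∪ T, hB.union_mem V hV T hT ⟨i, Finset.mem_inter.2 ⟨hiV, h⟩⟩,
        hXS, hYT.trans Finset.subset_union_right, Finset.union_left_comm _ _ _⟩
  have hAb : IsBuildingSet A := by
    refine ⟨?_, fun i => (hA _).2 (Or.inl (hB.singleton_mem i)), ?_⟩
    · intro V hV
      rcases (hA V).1 hV with h | ⟨S, hS, T, -, -, -, rfl⟩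
      · exact hB.nonempty_of_mem V h
      · exact (hB.nonempty_of_mem S hS).mono Finset.subset_union_left
    · intro V hV W hW hne
      rcases (hA V).1 hV with h | ⟨S, hS, T, hT, hXS, hYT, rfl⟩ <;>
        rcases (hA W).1 hW with h' | ⟨S', hS', T', hT', hXS', hYT', rfl⟩
      · exact (hA _).2 (Or.inl (hB.union_mem V h W h' hne))
      · exact hmix V h S' hS' T' hT' hXS' hYT' hne
      · rw [Finset.union_comm]
        exact hmix W h' S hS T hT hXS hYT (by rwa [Finset.inter_comm])
      · refine (hA _).2 (Or.inr ⟨S ∪ S', hB.union_mem S hS S' hS' ?_, T ∪ T',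
          hB.union_mem T hT T' hT' ?_, hXS.trans Finset.subset_union_left,
          hYT.trans Finset.subset_union_left, Finset.union_union_union_comm _ _ _ _⟩)
        · exact hXne.mono (Finset.subset_inter hXS hXS')
        · exact hYne.mono (Finset.subset_inter hYT hYT')
  have hsub : insert (X ∪ Y) B ⊆ A := by
    intro V hV
    rcases Finset.mem_insert.1 hV with rfl | h
    · exact (hA _).2 (Or.inr ⟨X, hX, Y, hY, subset_rfl, subset_rfl, rfl⟩)
    · exact (hA _).2 (Or.inl h)
  obtain ⟨S, hS, T, hT, -, -, rfl⟩ := ((hA U).1 (hC.2 ⟨hAb, hsub⟩ hU)).resolve_left hUB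
  refine ⟨S, hS, T, hT, ?_, rfl⟩
  rw [Finset.disjoint_iff_inter_eq_empty]
  by_contra hne
  exact hUB (hB.union_mem S hS T hT (Finset.nonempty_iff_ne_empty.2 hne))

theorem isDecomposition_pair (hB : IsBuildingSet B) {S T : Finset (Fin (n + 1))} (hS : S ∈ B)
    (hT : T ∈ B) (hST : Disjoint S T) (hU : S ∪ T ∉ B) : IsDecomposition B (S ∪ T) {S, T} := by
  refine ⟨⟨?_, ?_, by simp⟩, fun D' hD' => Finset.card_le_two.trans ?_⟩
  · simp [Finset.insert_subset_iff, hS, hT]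
  · intro X hX Y hY h
    simp only [Finset.mem_insert, Finset.mem_singleton] at hX hY
    rcases hX with rfl | rfl <;> rcases hY with rfl | rfl
    · exact absurd rfl h
    · exact hST
    · exact hST.symm
    · exact absurd rfl h
  · obtain ⟨hDB, -, hsup⟩ := hD'
    by_contra! hlt
    rcases (or_congr Finset.card_eq_zero Finset.card_eq_one).1
      (by omega : #D' = 0 ∨ #D' = 1) with rfl | ⟨X, rfl⟩
    · obtain ⟨i, hi⟩ := hB.nonempty_of_mem S hS
      have : i ∈ S ∪ T := Finset.mem_union_left _ hi
      rw [← hsup] at this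
      simp at this
    · simp at hsup hDB
      exact hU (hsup ▸ hDB)

end Combinatorics

end Nesto

namespace Nesto

/-! ### Pairing integer normals with real points -/

section Pairing

variable {n : ℕ}

/-- The pairing with an integer vector as a linear function. -/
def pairingHom (w : Fin n → ℤ) : (Fin n → ℝ) →ₗ[ℝ] ℝ :=
  ∑ i, (w i : ℝ) • LinearMap.proj i

theorem pairingHom_apply (w : Fin n → ℤ) (x : Fin n → ℝ) : pairingHom w x = pairing w x := by
  simp [pairingHom, pairing]

theorem pairing_add (w : Fin n → ℤ) (x y : Fin n → ℝ) :
    pairing w (x + y) = pairing w x + pairing w y := by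
  simp only [← pairingHom_apply, map_add]

theorem pairing_sub (w : Fin n → ℤ) (x y : Fin n → ℝ) :
    pairing w (x - y) = pairing w x - pairing w y := by
  simp only [← pairingHom_apply, map_sub]

theorem pairing_neg (w : Fin n → ℤ) (x : Fin n → ℝ) : pairing w (-x) = -pairing w x := by
  simp only [← pairingHom_apply, map_neg]

theorem pairing_smul (w : Fin n → ℤ) (r : ℝ) (x : Fin n → ℝ) :
    pairing w (r • x) = r * pairing w x := by
  simp only [← pairingHom_apply, map_smul, smul_eq_mul]

theorem add_pairing (w w' : Fin n → ℤ) (x : Fin n → ℝ) :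
    pairing (w + w') x = pairing w x + pairing w' x := by
  simp [pairing, add_mul, Finset.sum_add_distrib]

theorem continuous_pairing (w : Fin n → ℤ) : Continuous (pairing w) := by
  unfold pairing
  fun_prop

theorem sum_smul_pairing {κ : Type*} (s : Finset κ) (g : κ → ℤ) (w : κ → Fin n → ℤ)
    (x : Fin n → ℝ) : pairing (∑ i ∈ s, g i • w i) x = ∑ i ∈ s, (g i : ℝ) * pairing (w i) x := by
  simp only [pairing, Finset.sum_apply, Pi.smul_apply, smul_eq_mul, Int.cast_sum, Int.cast_mul,
    Finset.sum_mul, Finset.mul_sum, mul_assoc]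
  exact Finset.sum_comm

theorem pairing_single (w : Fin n → ℤ) (m : Fin n) : pairing w (Pi.single m 1) = w m := by
  simp [pairing, Pi.single_apply]

theorem pairing_intCast (w u : Fin n → ℤ) :
    pairing w (fun k => (u k : ℝ)) = ((∑ k, w k * u k : ℤ) : ℝ) := by
  simp [pairing]

end Pairing

/-! ### Polyhedra, vertices and the shaving step -/

section System

open Filter Topology

variable {n : ℕ} {ι : Type*}

/-- The polyhedron given by the inequalities `l i x ≤ b i`, `i ∈ I`. -/
def polyhedron (I : Finset ι) (l : ι → Fin n → ℤ) (b : ι → ℝ) : Set (Fin n → ℝ) :=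
  {x | ∀ i ∈ I, pairing (l i) x ≤ b i}

variable {I : Finset ι} {l : ι → Fin n → ℤ} {b : ι → ℝ}

theorem isClosed_polyhedron : IsClosed (polyhedron I l b) := by
  have : polyhedron I l b = ⋂ i ∈ I, {x | pairing (l i) x ≤ b i} := by
    ext x
    simp [polyhedron]
  rw [this]
  exact isClosed_biInter fun i _ => isClosed_le (continuous_pairing _) continuous_const

theorem convex_polyhedron : Convex ℝ (polyhedron I l b) := by
  have : polyhedron I l b = ⋂ i ∈ I, {x | pairingHom (l i) x ≤ b i} := by
    ext x
    simp [polyhedron, pairingHom_apply]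
  rw [this]
  exact convex_iInter₂ fun i _ => convex_halfSpace_le (pairingHom (l i)).isLinear _

theorem eventually_add_smul_mem {x d : Fin n → ℝ} (hx : x ∈ polyhedron I l b)
    (hd : ∀ i ∈ I, pairing (l i) x = b i → pairing (l i) d ≤ 0) :
    ∀ᶠ t in 𝓝[>] (0 : ℝ), x + t • d ∈ polyhedron I l b := by
  simp only [polyhedron, Set.mem_ofPred_eq]
  rw [Filter.eventually_all_finset]
  intro i hi
  by_cases h : pairing (l i) x = b i
  · filter_upwards [self_mem_nhdsWithin] with t ht
    rw [pairing_add, pairing_smul, h]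
    nlinarith [hd i hi h, Set.mem_Ioi.1 ht]
  · have hlt : pairing (l i) x < b i := lt_of_le_of_ne (hx i hi) h
    have hc : Continuous fun t : ℝ => pairing (l i) (x + t • d) :=
      (continuous_pairing _).comp (by fun_prop)
    have := hc.tendsto 0
    simp only [zero_smul, add_zero] at this
    exact ((this.eventually_lt_const hlt).filter_mono nhdsWithin_le_nhds).mono fun t ht => ht.le

/-- A point of a polyhedron is a vertex iff the normals of its tight inequalities have no common
zero besides `0`. -/
theorem mem_extremePoints_iff {x : Fin n → ℝ} (hx : x ∈ polyhedron I l b) :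
    x ∈ (polyhedron I l b).extremePoints ℝ ↔
      ∀ d, (∀ i ∈ I, pairing (l i) x = b i → pairing (l i) d = 0) → d = 0 := by
  constructor
  · intro hext d hd
    have h₁ := eventually_add_smul_mem hx fun i hi h => (hd i hi h).le
    have h₂ := eventually_add_smul_mem (d := -d) hx
      fun i hi h => by rw [pairing_neg, hd i hi h, neg_zero]
    obtain ⟨t, ⟨hp, hm⟩, ht⟩ := ((h₁.and h₂).and self_mem_nhdsWithin).exists
    have hmem : x ∈ openSegment ℝ (x + t • d) (x + t • -d) := by
      refine ⟨1 / 2, 1 / 2, by norm_num, by norm_num, by norm_num, ?_⟩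
      ext k
      simp
      ring
    have h := hext.2 hp hm hmem
    have h : t • d = 0 := by simpa using h
    exact (smul_eq_zero.1 h).resolve_left (ne_of_gt ht)
  · intro h
    refine ⟨hx, ?_⟩
    rintro y hy z hz ⟨p, q, hp, hq, hpq, rfl⟩
    have hyz : y - z = 0 := by
      refine h _ fun i hi htight => ?_
      rw [pairing_add, pairing_smul, pairing_smul] at htight
      have h₁ := hy i hi
      have h₂ := hz i hi
      have hb : b i = p * b i + q * b i := by rw [← add_mul, hpq, one_mul]
      have e₁ : pairing (l i) y = b i := by nlinarith
      have e₂ : pairing (l i) z = b i := by nlinarith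
      rw [pairing_sub, e₁, e₂, sub_self]
    rw [sub_eq_zero] at hyz
    subst hyz
    rw [← add_smul, hpq, one_smul]

theorem finite_extremePoints : ((polyhedron I l b).extremePoints ℝ).Finite := by
  classical
  -- A vertex is determined by its set of tight inequalities.
  refine Set.Finite.of_finite_image (f := fun x => I.filter fun i => pairing (l i) x = b i)
    (Set.Finite.subset (I.powerset.finite_toSet) ?_) ?_
  · rintro _ ⟨x, -, rfl⟩
    exact Finset.mem_coe.2 (Finset.mem_powerset.2 (Finset.filter_subset _ _))
  · intro x hx y hy hxy
    have hxy : (I.filter fun i => pairing (l i) x = b i) =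
      I.filter fun i => pairing (l i) y = b i := hxy
    have h := (mem_extremePoints_iff hx.1).1 hx (x - y) fun i hi hti => ?_
    · exact sub_eq_zero.1 h
    · have : i ∈ I.filter fun i => pairing (l i) y = b i := by
        rw [← hxy]
        simp [hi, hti]
      rw [pairing_sub, hti, (Finset.mem_filter.1 this).2, sub_self]

theorem polyhedron_eq_convexHull (hbd : Bornology.IsBounded (polyhedron I l b)) :
    polyhedron I l b = convexHull ℝ ((polyhedron I l b).extremePoints ℝ) := by
  have hc : IsCompact (polyhedron I l b) :=
    Metric.isCompact_of_isClosed_isBounded isClosed_polyhedron hbd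
  conv_lhs => rw [← closure_convexHull_extremePoints hc convex_polyhedron]
  exact (finite_extremePoints.isCompact_convexHull ℝ).isClosed.closure_eq

/-- A system of inequalities with integer normals which defines a polytope with interior points such
that at each vertex the normals of the tight inequalities have an integer dual family. -/
structure IsUnimodular (I : Finset ι) (l : ι → Fin n → ℤ) (b : ι → ℝ) : Prop where
  bounded : Bornology.IsBounded (polyhedron I l b)
  interior : ∃ x, ∀ i ∈ I, pairing (l i) x < b i
  dual : ∀ v ∈ (polyhedron I l b).extremePoints ℝ, ∃ u : ι → Fin n → ℤ,
    ∀ i ∈ I, pairing (l i) v = b i → ∀ j ∈ I, pairing (l j) v = b j →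
      (i = j → pairing (l i) (fun k => (u j k : ℝ)) = 1) ∧
      (i ≠ j → pairing (l i) (fun k => (u j k : ℝ)) = 0)

theorem mem_polyhedron_insert [DecidableEq ι] {s : ι} {x : Fin n → ℝ} :
    x ∈ polyhedron (insert s I) l b ↔ pairing (l s) x ≤ b s ∧ x ∈ polyhedron I l b := by
  simp [polyhedron]

/-- Some vertex lies off the facet of `s₁`, hence satisfies the new inequality strictly. A short
step from it towards an old interior point makes all inequalities strict. -/
theorem IsUnimodular.exists_interior_insert [DecidableEq ι] (h : IsUnimodular I l b) {s s₁ s₂ : ι} (hs₁ : s₁ ∈ I)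
    (hv : ∀ v ∈ (polyhedron I l b).extremePoints ℝ,
      ¬ (pairing (l s₁) v = b s₁ ∧ pairing (l s₂) v = b s₂) → pairing (l s) v < b s) :
    ∃ x, ∀ i ∈ insert s I, pairing (l i) x < b i := by
  obtain ⟨x₀, hx₀⟩ := h.interior
  obtain ⟨w, hw, hws⟩ : ∃ w ∈ (polyhedron I l b).extremePoints ℝ, pairing (l s₁) w < b s₁ := by
    by_contra! hcon
    have hmem : x₀ ∈ polyhedron I l b := fun i hi => (hx₀ i hi).le
    rw [polyhedron_eq_convexHull h.bounded] at hmem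
    have hc : Convex ℝ {x | b s₁ ≤ pairingHom (l s₁) x} :=
      convex_halfSpace_ge (pairingHom (l s₁)).isLinear _
    have := convexHull_min (fun w hw => by simpa [pairingHom_apply] using hcon w hw) hc hmem
    simp only [Set.mem_ofPred_eq, pairingHom_apply] at this
    exact absurd this (not_le.2 (hx₀ s₁ hs₁))
  have hlt := hv w hw fun h => hws.ne h.1
  have hc : Continuous fun t : ℝ => pairing (l s) (w + t • (x₀ - w)) :=
    (continuous_pairing _).comp (by fun_prop)
  have htend := hc.tendsto 0
  simp only [zero_smul, add_zero] at htend
  have h₁ := (htend.eventually_lt_const hlt).filter_mono (nhdsWithin_le_nhds (s := Set.Ioi 0))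
  have h₂ : ∀ᶠ t in 𝓝[>] (0 : ℝ), t < 1 :=
    (eventually_lt_nhds one_pos).filter_mono nhdsWithin_le_nhds
  obtain ⟨t, ⟨ht, ht1⟩, ht0⟩ := ((h₁.and h₂).and self_mem_nhdsWithin).exists
  have ht0 : 0 < t := ht0
  refine ⟨w + t • (x₀ - w), fun i hi => ?_⟩
  rcases Finset.mem_insert.1 hi with rfl | hi
  · exact ht
  · rw [pairing_add, pairing_smul, pairing_sub]
    nlinarith [hx₀ i hi, hw.1 i hi]

/-- The edge of a polytope through the point `v` in direction `d` ends in a vertex, if `d` spans the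
common zero space of the normals of the inequalities tight at `v`. -/
theorem exists_extremePoint_of_ray (hbd : Bornology.IsBounded (polyhedron I l b))
    {v d : Fin n → ℝ} (hv : v ∈ polyhedron I l b) (hd0 : d ≠ 0)
    (hd : ∀ i ∈ I, pairing (l i) v = b i → pairing (l i) d = 0)
    (hker : ∀ d', (∀ i ∈ I, pairing (l i) v = b i → pairing (l i) d' = 0) → ∃ r : ℝ, d' = r • d) :
    ∃ t : ℝ, 0 ≤ t ∧ v + t • d ∈ (polyhedron I l b).extremePoints ℝ := by
  have hc : IsCompact {t : ℝ | 0 ≤ t ∧ v + t • d ∈ polyhedron I l b} := by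
    refine Metric.isCompact_of_isClosed_isBounded ?_ ?_
    · exact isClosed_Ici.inter (isClosed_polyhedron.preimage (by fun_prop))
    · obtain ⟨R, hR⟩ := hbd.exists_norm_le
      refine isBounded_iff_forall_norm_le.2 ⟨(R + ‖v‖) / ‖d‖, fun t ht => ?_⟩
      rw [le_div_iff₀ (norm_pos_iff.2 hd0), ← norm_smul]
      calc ‖t • d‖ = ‖(v + t • d) - v‖ := by simp
        _ ≤ ‖v + t • d‖ + ‖v‖ := norm_sub_le _ _
        _ ≤ R + ‖v‖ := by gcongr; exact hR _ ht.2
  obtain ⟨t, ⟨ht0, htP⟩, htmax⟩ :=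
    hc.exists_isMaxOn ⟨0, le_rfl, by simpa using hv⟩ continuous_id.continuousOn
  refine ⟨t, ht0, (mem_extremePoints_iff htP).2 fun d' hd' => ?_⟩
  have htight : ∀ i ∈ I, pairing (l i) v = b i → pairing (l i) (v + t • d) = b i := by
    intro i hi h
    rw [pairing_add, pairing_smul, hd i hi h, mul_zero, add_zero, h]
  obtain ⟨r, rfl⟩ := hker d' fun i hi h => hd' i hi (htight i hi h)
  -- At the largest admissible parameter some tight inequality blocks further motion; its normal is
  -- nonzero on `d`.
  obtain ⟨m, hm, hmt, hmd⟩ : ∃ m ∈ I, pairing (l m) (v + t • d) = b m ∧ 0 < pairing (l m) d := by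
    by_contra! hcon
    obtain ⟨s, hs, hs0⟩ := ((eventually_add_smul_mem htP hcon).and self_mem_nhdsWithin).exists
    have hs0 : 0 < s := hs0
    have : t + s ≤ t := htmax (a := t + s) ⟨by positivity, by rwa [add_smul, ← add_assoc]⟩
    linarith
  have := hd' m hm hmt
  rw [pairing_smul] at this
  rw [(mul_eq_zero.1 this).resolve_right hmd.ne', zero_smul]

/-- Shaving off the face `l s₁ x = b s₁, l s₂ x = b s₂` by an inequality with normal
`l s₁ + l s₂` preserves unimodularity. -/
theorem IsUnimodular.insert [DecidableEq ι] (h : IsUnimodular I l b) {s s₁ s₂ : ι} (hs : s ∉ I) (hs₁ : s₁ ∈ I)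
    (hs₂ : s₂ ∈ I) (hne : s₁ ≠ s₂) (hl : l s = l s₁ + l s₂) (hb : b s < b s₁ + b s₂)
    (hshave : ∀ v ∈ (polyhedron I l b).extremePoints ℝ,
      ¬ (pairing (l s₁) v = b s₁ ∧ pairing (l s₂) v = b s₂) → pairing (l s) v < b s) :
    IsUnimodular (insert s I) l b := by
  refine ⟨h.bounded.subset fun x hx => (mem_polyhedron_insert.1 hx).2,
    h.exists_interior_insert hs₁ hshave, fun v hv => ?_⟩
  have hvP := (mem_polyhedron_insert.1 hv.1).2
  have hvs := (mem_polyhedron_insert.1 hv.1).1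
  have hker := (mem_extremePoints_iff hv.1).1 hv
  have hsI : ∀ i ∈ I, i ≠ s := fun i hi h => hs (h ▸ hi)
  rcases hvs.lt_or_eq with hlt | heq
  · have hvext : v ∈ (polyhedron I l b).extremePoints ℝ := by
      refine (mem_extremePoints_iff hvP).2 fun d hd => hker d fun i hi hti => ?_
      rcases Finset.mem_insert.1 hi with rfl | hi
      · exact absurd hti hlt.ne
      · exact hd i hi hti
    obtain ⟨u, hu⟩ := h.dual v hvext
    refine ⟨u, fun i hi hti j hj htj => ?_⟩
    rcases Finset.mem_insert.1 hi with rfl | hi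
    · exact absurd hti hlt.ne
    rcases Finset.mem_insert.1 hj with rfl | hj
    · exact absurd htj hlt.ne
    exact hu i hi hti j hj htj
  -- Now `v` lies on the new facet; it is an inner point of an edge of the old polytope.
  have hbig : ∀ w ∈ (polyhedron I l b).extremePoints ℝ, b s ≤ pairing (l s) w →
      pairing (l s₁) w = b s₁ ∧ pairing (l s₂) w = b s₂ := by
    intro w hw hle
    by_contra hcon
    exact absurd (hshave w hw hcon) (not_lt.2 hle)
  have hker' : ∀ d, (∀ i ∈ I, pairing (l i) v = b i → pairing (l i) d = 0) →
      pairing (l s) d = 0 → d = 0 := by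
    intro d hd hds
    refine hker d fun i hi hti => ?_
    rcases Finset.mem_insert.1 hi with rfl | hi
    · exact hds
    · exact hd i hi hti
  obtain ⟨d, hd, hds⟩ : ∃ d, (∀ i ∈ I, pairing (l i) v = b i → pairing (l i) d = 0) ∧
      0 < pairing (l s) d := by
    -- Otherwise `v` would be an old vertex with the new inequality tight, hence on the shaved face,
    -- where the new normal takes the value `b s₁ + b s₂ > b s`.
    by_contra! hcon
    have hvext : v ∈ (polyhedron I l b).extremePoints ℝ := by
      refine (mem_extremePoints_iff hvP).2 fun d hd => hker' d hd (le_antisymm (hcon d hd) ?_)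
      have := hcon (-d) fun i hi hti => by rw [pairing_neg, hd i hi hti, neg_zero]
      rw [pairing_neg] at this
      linarith
    obtain ⟨h₁, h₂⟩ := hbig v hvext heq.ge
    rw [hl, add_pairing, h₁, h₂] at heq
    linarith
  have hline : ∀ d', (∀ i ∈ I, pairing (l i) v = b i → pairing (l i) d' = 0) →
      ∃ r : ℝ, d' = r • d := by
    intro d' hd'
    refine ⟨pairing (l s) d' / pairing (l s) d, sub_eq_zero.1 (hker' _ (fun i hi hti => ?_) ?_)⟩
    · rw [pairing_sub, pairing_smul, hd i hi hti, hd' i hi hti, mul_zero, sub_zero]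
    · rw [pairing_sub, pairing_smul, div_mul_cancel₀ _ hds.ne', sub_self]
  have hd0 : d ≠ 0 := by
    rintro rfl
    rw [← pairingHom_apply, map_zero] at hds
    exact hds.false
  obtain ⟨t, ht0, hw⟩ := exists_extremePoint_of_ray h.bounded hvP hd0 hd hline
  set w := v + t • d with hwdef
  -- Along `d` the new normal increases, so the far end `w` of the edge is among the vertices cut
  -- off.
  obtain ⟨hw₁, hw₂⟩ := hbig w hw (by
    rw [hwdef, pairing_add, pairing_smul, heq]
    nlinarith)
  have htight : ∀ i ∈ I, pairing (l i) v = b i → pairing (l i) w = b i := by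
    intro i hi hti
    rw [hwdef, pairing_add, pairing_smul, hd i hi hti, mul_zero, add_zero, hti]
  obtain ⟨u, hu⟩ := h.dual w hw
  -- Here `m` is the old inequality lost in passing from `w` to `v`. Its dual vector now serves `s`,
  -- and `u p` is corrected so as to vanish on `l s = l m + l p`.
  have main : ∀ m ∈ I, ∀ p ∈ I, m ≠ p → pairing (l m) w = b m → pairing (l p) w = b p →
      pairing (l m) v ≠ b m → l s = l m + l p →
      ∃ u : ι → Fin n → ℤ, ∀ i ∈ Insert.insert s I, pairing (l i) v = b i →
        ∀ j ∈ Insert.insert s I, pairing (l j) v = b j →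
        (i = j → pairing (l i) (fun k => (u j k : ℝ)) = 1) ∧
        (i ≠ j → pairing (l i) (fun k => (u j k : ℝ)) = 0) := by
    intro m hm p hp hmp htm htp hntm hlmp
    have hup : (fun k => ((u p - u m) k : ℝ)) =
        (fun k => (u p k : ℝ)) - (fun k => (u m k : ℝ)) := by
      ext k
      simp
    have hpm := hu p hp htp m hm htm
    have hmm := hu m hm htm m hm htm
    have hmp' := hu m hm htm p hp htp
    have hpp := hu p hp htp p hp htp
    refine ⟨fun j => if j = s then u m else if j = p then u p - u m else u j, ?_⟩
    intro i hi₀ hti j hj₀ htj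
    rcases Finset.mem_insert.1 hi₀ with hi' | hi <;> rcases Finset.mem_insert.1 hj₀ with hj' | hj
    · subst hi' hj'
      refine ⟨fun _ => ?_, fun h => absurd rfl h⟩
      simp only [if_true]
      rw [hlmp, add_pairing, hmm.1 rfl, hpm.2 hmp.symm, add_zero]
    · subst hi'
      refine ⟨fun h => absurd h.symm (hsI j hj), fun _ => ?_⟩
      have hjm : m ≠ j := by
        rintro rfl
        exact hntm htj
      simp only [if_neg (hsI j hj)]
      by_cases hjp : j = p
      · subst hjp
        simp only [if_true]
        rw [hup, hlmp, add_pairing, pairing_sub, pairing_sub, hmp'.2 hmp, hmm.1 rfl, hpp.1 rfl,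
          hpm.2 hmp.symm]
        ring
      · simp only [if_neg hjp]
        have htjw := htight j hj htj
        rw [hlmp, add_pairing, (hu m hm htm j hj htjw).2 hjm,
          (hu p hp htp j hj htjw).2 (Ne.symm hjp), add_zero]
    · subst hj'
      refine ⟨fun h => absurd h (hsI i hi), fun _ => ?_⟩
      simp only [if_true]
      refine (hu i hi (htight i hi hti) m hm htm).2 ?_
      rintro rfl
      exact hntm hti
    · have hiw := htight i hi hti
      have hjw := htight j hj htj
      have him : i ≠ m := by
        rintro rfl
        exact hntm hti
      simp only [if_neg (hsI j hj)]
      by_cases hjp : j = p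
      · subst hjp
        simp only [if_true]
        rw [hup, pairing_sub, (hu i hi hiw m hm htm).2 him, sub_zero]
        exact hu i hi hiw j hj hjw
      · simp only [if_neg hjp]
        exact hu i hi hiw j hj hjw
  by_cases h₁ : pairing (l s₁) v = b s₁
  · have h₂ : pairing (l s₂) v ≠ b s₂ := by
      intro h₂
      rw [hl, add_pairing, h₁, h₂] at heq
      linarith
    exact main s₂ hs₂ s₁ hs₁ hne.symm hw₂ hw₁ h₂ (by rw [hl, add_comm])
  · exact main s₁ hs₁ s₂ hs₂ hne hw₁ hw₂ h₁ hl

end System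

/-! ### From dual families to the Delzant property -/

section Delzant

open Filter Topology

variable {n : ℕ} {ι : Type*} {I : Finset ι} {l : ι → Fin n → ℤ} {b : ι → ℝ}

/-- The dual family at a vertex, indexed by the tight inequalities, and the resulting expansion. -/
theorem IsUnimodular.exists_dual (h : IsUnimodular I l b) {v : Fin n → ℝ}
    (hv : v ∈ (polyhedron I l b).extremePoints ℝ) :
    ∃ u : {i // i ∈ I ∧ pairing (l i) v = b i} → Fin n → ℤ,
      (∀ i : {i // i ∈ I ∧ pairing (l i) v = b i}, pairing (l i) (fun k => (u i k : ℝ)) = 1) ∧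
      (∀ i j : {i // i ∈ I ∧ pairing (l i) v = b i}, i ≠ j →
        pairing (l i) (fun k => (u j k : ℝ)) = 0) := by
  obtain ⟨u, hu⟩ := h.dual v hv
  exact ⟨fun i => u i, fun i => (hu i i.2.1 i.2.2 i i.2.1 i.2.2).1 rfl,
    fun i j hij => (hu i i.2.1 i.2.2 j j.2.1 j.2.2).2 fun h => hij (Subtype.ext h)⟩

theorem finite_tight (v : Fin n → ℝ) : Finite {i // i ∈ I ∧ pairing (l i) v = b i} :=
  Finite.of_injective (fun i => (⟨i.1, i.2.1⟩ : I)) fun i j hij => by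
    simpa [Subtype.ext_iff] using hij

/-- The difference of the two sides is annihilated by every tight normal, so it vanishes because `v`
is a vertex. -/
theorem eq_sum_of_dual {v : Fin n → ℝ} (hv : v ∈ (polyhedron I l b).extremePoints ℝ)
    [Fintype {i // i ∈ I ∧ pairing (l i) v = b i}]
    {u : {i // i ∈ I ∧ pairing (l i) v = b i} → Fin n → ℤ}
    (h₁ : ∀ i : {i // i ∈ I ∧ pairing (l i) v = b i}, pairing (l i) (fun k => (u i k : ℝ)) = 1)
    (h₀ : ∀ i j : {i // i ∈ I ∧ pairing (l i) v = b i}, i ≠ j →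
        pairing (l i) (fun k => (u j k : ℝ)) = 0) (x : Fin n → ℝ) :
    x = ∑ i : {i // i ∈ I ∧ pairing (l i) v = b i},
      pairing (l i) x • (fun k => (u i k : ℝ)) := by
  refine sub_eq_zero.1 ((mem_extremePoints_iff hv.1).1 hv _ fun j hj htj => ?_)
  have hsum : ∑ i : {i // i ∈ I ∧ pairing (l i) v = b i},
      pairing (l (i : ι)) x * pairing (l j) (fun k => (u i k : ℝ)) = pairing (l j) x := by
    rw [Finset.sum_eq_single_of_mem ⟨j, hj, htj⟩ (Finset.mem_univ _)]
    · rw [h₁ ⟨j, hj, htj⟩, mul_one]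
    · intro i _ hi
      rw [h₀ ⟨j, hj, htj⟩ i hi.symm, mul_zero]
  rw [pairing_sub, ← pairingHom_apply (l j) (Finset.sum _ _), map_sum]
  simp only [map_smul, smul_eq_mul, pairingHom_apply, hsum, sub_self]

theorem IsUnimodular.exists_basis (h : IsUnimodular I l b) {v : Fin n → ℝ}
    (hv : v ∈ (polyhedron I l b).extremePoints ℝ) :
    ∃ a : Module.Basis {i // i ∈ I ∧ pairing (l i) v = b i} ℤ (Fin n → ℤ),
      ∀ i, a i = l i := by
  obtain ⟨u, h₁, h₀⟩ := h.exists_dual hv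
  have := finite_tight (I := I) (l := l) (b := b) v
  have := Fintype.ofFinite {i // i ∈ I ∧ pairing (l i) v = b i}
  have hexp := eq_sum_of_dual hv h₁ h₀
  have hli : LinearIndependent ℤ fun i : {i // i ∈ I ∧ pairing (l i) v = b i} => l i := by
    rw [Fintype.linearIndependent_iff]
    intro g hg j
    have hz : ∑ i, (g i : ℝ) * pairing (l i.1) (fun k => (u j k : ℝ)) = 0 := by
      rw [← sum_smul_pairing, hg]
      simp [pairing]
    rw [Finset.sum_eq_single_of_mem j (Finset.mem_univ _), h₁ j, mul_one] at hz
    · exact_mod_cast hz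
    · intro i _ hi
      rw [h₀ i j hi, mul_zero]
  have hsp : ⊤ ≤ Submodule.span ℤ
      (Set.range fun i : {i // i ∈ I ∧ pairing (l i) v = b i} => l i) := by
    intro w _
    -- Pairing `w` with the expansion of each unit vector in the dual family gives these
    -- coefficients, which are integers because the dual vectors are.
    have hw : w = ∑ i : {i // i ∈ I ∧ pairing (l i) v = b i}, (∑ k, w k * u i k) • l i := by
      ext m
      have := congrArg (pairing w) (hexp (Pi.single m 1))
      rw [← pairingHom_apply w (Finset.sum _ _), map_sum] at this
      simp only [map_smul, smul_eq_mul, pairingHom_apply, pairing_intCast, pairing_single] at this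
      simp only [Finset.sum_apply, Pi.smul_apply, smul_eq_mul]
      have hm : ((w m : ℤ) : ℝ) = ((∑ i : {i // i ∈ I ∧ pairing (l i) v = b i},
          l i m * ∑ k, w k * u i k : ℤ) : ℝ) := by
        rw [this]
        push_cast
        rfl
      rw [Int.cast_inj.1 hm]
      exact Finset.sum_congr rfl fun i _ => mul_comm _ _
    rw [hw]
    exact Submodule.sum_mem _ fun i _ => Submodule.smul_mem _ _ (Submodule.subset_span ⟨i, rfl⟩)
  exact ⟨Module.Basis.mk hli hsp, fun i => Module.Basis.mk_apply hli hsp i⟩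

theorem IsUnimodular.affDim_eq (h : IsUnimodular I l b) : affDim (polyhedron I l b) = n := by
  obtain ⟨x, hx⟩ := h.interior
  have hU : IsOpen {x : Fin n → ℝ | ∀ i ∈ I, pairing (l i) x < b i} := by
    have : {x : Fin n → ℝ | ∀ i ∈ I, pairing (l i) x < b i} =
        ⋂ i ∈ I, {x | pairing (l i) x < b i} := by
      ext x
      simp
    rw [this]
    exact isOpen_biInter_finset fun i _ => isOpen_lt (continuous_pairing _) continuous_const
  have hspan : affineSpan ℝ (polyhedron I l b) = ⊤ := by
    refine top_le_iff.1 ?_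
    rw [← hU.affineSpan_eq_top ⟨x, hx⟩]
    exact affineSpan_mono ℝ fun y hy i hi => (hy i hi).le
  rw [affDim, ← direction_affineSpan, hspan, AffineSubspace.direction_top, finrank_top]
  simp

/-- The face of a polyhedron on which the `i`-th inequality is tight. -/
def tightFace (I : Finset ι) (l : ι → Fin n → ℤ) (b : ι → ℝ) (i : ι) : Set (Fin n → ℝ) :=
  {x ∈ polyhedron I l b | pairing (l i) x = b i}

theorem tightFace_eq {i : ι} (hi : i ∈ I) {v : Fin n → ℝ} (hv : v ∈ polyhedron I l b)
    (hti : pairing (l i) v = b i) :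
    tightFace I l b i =
      {x ∈ polyhedron I l b | ∀ y ∈ polyhedron I l b, pairing (l i) y ≤ pairing (l i) x} := by
  ext x
  refine and_congr_right fun hx => ⟨fun h y hy => h ▸ hy i hi, fun h => ?_⟩
  exact le_antisymm (hx i hi) (hti ▸ h v hv)

theorem isExposed_tightFace {i : ι} (hi : i ∈ I) {v : Fin n → ℝ} (hv : v ∈ polyhedron I l b)
    (hti : pairing (l i) v = b i) : IsExposed ℝ (polyhedron I l b) (tightFace I l b i) := by
  intro _
  refine ⟨LinearMap.toContinuousLinearMap (pairingHom (l i)), ?_⟩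
  rw [tightFace_eq hi hv hti]
  simp [pairingHom_apply]

theorem vectorSpan_le_ker {F : Set (Fin n → ℝ)} {i : ι} (hF : F ⊆ tightFace I l b i) :
    vectorSpan ℝ F ≤ LinearMap.ker (pairingHom (l i)) := by
  refine Submodule.span_le.2 ?_
  rintro _ ⟨x, hx, y, hy, rfl⟩
  simp [pairingHom_apply, (hF hx).2, (hF hy).2, pairing_sub]

theorem finrank_ker_add_one {w : Fin n → ℤ} {x : Fin n → ℝ} (hx : pairing w x ≠ 0) :
    Module.finrank ℝ (LinearMap.ker (pairingHom w)) + 1 = n := by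
  have hs : Function.Surjective (pairingHom w) := by
    apply LinearMap.surjective
    intro h
    exact hx (by simpa [pairingHom_apply] using LinearMap.congr_fun h x)
  have := (pairingHom w).finrank_range_add_finrank_ker
  rw [LinearMap.range_eq_top.2 hs, finrank_top, Module.finrank_self] at this
  simp at this
  omega

section Vertex

variable {v : Fin n → ℝ} (hv : v ∈ (polyhedron I l b).extremePoints ℝ)
    {u : {i // i ∈ I ∧ pairing (l i) v = b i} → Fin n → ℤ}
    (h₁ : ∀ i : {i // i ∈ I ∧ pairing (l i) v = b i}, pairing (l i) (fun k => (u i k : ℝ)) = 1)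
    (h₀ : ∀ i j : {i // i ∈ I ∧ pairing (l i) v = b i}, i ≠ j →
        pairing (l i) (fun k => (u j k : ℝ)) = 0)

include hv h₁ h₀

theorem eventually_sub_dual_mem (j : {i // i ∈ I ∧ pairing (l i) v = b i}) :
    ∀ᶠ t in 𝓝[>] (0 : ℝ), v + t • (-fun k => (u j k : ℝ)) ∈ polyhedron I l b := by
  refine eventually_add_smul_mem hv.1 fun i hi hti => ?_
  rw [pairing_neg]
  by_cases hij : (⟨i, hi, hti⟩ : {i // i ∈ I ∧ pairing (l i) v = b i}) = j
  · subst hij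
    rw [h₁ ⟨i, hi, hti⟩]
    norm_num
  · rw [h₀ ⟨i, hi, hti⟩ j hij, neg_zero]

/-- A short move from `v` along `-u j` leaves only the `j`-th facet and stays in all other tight
ones. -/
theorem dual_mem_vectorSpan {i j : {i // i ∈ I ∧ pairing (l i) v = b i}} (hij : i ≠ j) :
    (fun k => (u j k : ℝ)) ∈ vectorSpan ℝ (tightFace I l b i) := by
  obtain ⟨t, ht, ht0⟩ :=
    ((eventually_sub_dual_mem hv h₁ h₀ j).and self_mem_nhdsWithin).exists
  have ht0 : 0 < t := ht0
  have hmem : v + t • (-fun k => (u j k : ℝ)) ∈ tightFace I l b i := by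
    refine ⟨ht, ?_⟩
    rw [pairing_add, pairing_smul, pairing_neg, h₀ i j hij, i.2.2]
    simp
  have := vsub_mem_vectorSpan ℝ (show v ∈ tightFace I l b i from ⟨hv.1, i.2.2⟩) hmem
  have h := Submodule.smul_mem _ t⁻¹ this
  convert h using 1
  simp [smul_smul, ht0.ne']

theorem vectorSpan_tightFace (i : {i // i ∈ I ∧ pairing (l i) v = b i}) :
    vectorSpan ℝ (tightFace I l b i) = LinearMap.ker (pairingHom (l i)) := by
  have := finite_tight (I := I) (l := l) (b := b) v
  have := Fintype.ofFinite {i // i ∈ I ∧ pairing (l i) v = b i}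
  refine le_antisymm (vectorSpan_le_ker subset_rfl) fun x hx => ?_
  rw [LinearMap.mem_ker, pairingHom_apply] at hx
  rw [eq_sum_of_dual hv h₁ h₀ x]
  refine Submodule.sum_mem _ fun j _ => ?_
  by_cases hij : i = j
  · rw [← hij, hx, zero_smul]
    exact Submodule.zero_mem _
  · exact Submodule.smul_mem _ _ (dual_mem_vectorSpan hv h₁ h₀ hij)

theorem isFacet_tightFace (hdim : affDim (polyhedron I l b) = n)
    (i : {i // i ∈ I ∧ pairing (l i) v = b i}) :
    IsFacet (polyhedron I l b) (tightFace I l b i) := by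
  refine ⟨isExposed_tightFace i.2.1 hv.1 i.2.2, ⟨v, hv.1, i.2.2⟩, ?_⟩
  rw [hdim, affDim, vectorSpan_tightFace hv h₁ h₀ i]
  exact finrank_ker_add_one (x := fun k => (u i k : ℝ)) (by rw [h₁ i]; norm_num)

theorem tightFace_injective :
    Function.Injective fun i : {i // i ∈ I ∧ pairing (l i) v = b i} => tightFace I l b i := by
  intro i j hij
  by_contra hne
  have hmem := dual_mem_vectorSpan hv h₁ h₀ hne
  have hij : tightFace I l b i = tightFace I l b j := hij
  rw [hij] at hmem
  have := vectorSpan_le_ker subset_rfl hmem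
  rw [LinearMap.mem_ker, pairingHom_apply, h₁ j] at this
  norm_num at this

/-- A functional exposing `F` is a nonnegative combination of the tight normals, with coefficients
its values on the dual vectors. A positive coefficient puts `F` inside the corresponding tight face,
and equality follows by comparing dimensions. -/
theorem exists_eq_tightFace (hdim : affDim (polyhedron I l b) = n) {F : Set (Fin n → ℝ)}
    (hF : IsFacet (polyhedron I l b) F) (hvF : v ∈ F) :
    ∃ i : {i // i ∈ I ∧ pairing (l i) v = b i}, F = tightFace I l b i := by
  have := finite_tight (I := I) (l := l) (b := b) v
  have := Fintype.ofFinite {i // i ∈ I ∧ pairing (l i) v = b i}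
  obtain ⟨hexp, hne, hFd⟩ := hF
  obtain ⟨c, hc⟩ := hexp hne
  have hmax : ∀ y ∈ polyhedron I l b, c y ≤ c v := by
    rw [hc] at hvF
    exact hvF.2
  have hFiff : ∀ x ∈ polyhedron I l b, x ∈ F ↔ c x = c v := by
    intro x hx
    rw [hc]
    exact ⟨fun h => le_antisymm (hmax x hx) (h.2 v hv.1), fun h => ⟨hx, fun y hy => h ▸ hmax y hy⟩⟩
  have hFP : F ⊆ polyhedron I l b := hexp.subset
  have hcu : ∀ j, 0 ≤ c (fun k => (u j k : ℝ)) := by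
    intro j
    obtain ⟨t, ht, ht0⟩ :=
      ((eventually_sub_dual_mem hv h₁ h₀ j).and self_mem_nhdsWithin).exists
    have ht0 : 0 < t := ht0
    have := hmax _ ht
    rw [map_add, map_smul, map_neg, smul_eq_mul] at this
    nlinarith
  have hcx : ∀ x, c (v - x) = ∑ i : {i // i ∈ I ∧ pairing (l i) v = b i},
      (b i - pairing (l i) x) * c (fun k => (u i k : ℝ)) := by
    intro x
    conv_lhs => rw [eq_sum_of_dual hv h₁ h₀ (v - x)]
    rw [map_sum]
    refine Finset.sum_congr rfl fun i _ => ?_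
    rw [map_smul, smul_eq_mul, pairing_sub, i.2.2]
  obtain ⟨i, hi⟩ : ∃ i, 0 < c (fun k => (u i k : ℝ)) := by
    by_contra! hcon
    -- With all coefficients zero the functional is constant and `F` is the whole polytope, which
    -- has the wrong dimension.
    have hFe : F = polyhedron I l b := by
      refine hFP.antisymm fun x hx => (hFiff x hx).2 ?_
      have := hcx x
      rw [Finset.sum_eq_zero fun i _ => by rw [le_antisymm (hcon i) (hcu i), mul_zero],
        map_sub] at this
      linarith
    rw [hFe] at hFd
    omega
  have hFi : F ⊆ tightFace I l b i := by
    intro x hx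
    refine ⟨hFP hx, ?_⟩
    have h := hcx x
    rw [map_sub, (hFiff x (hFP hx)).1 hx, sub_self] at h
    have h := (Finset.sum_eq_zero_iff_of_nonneg
      fun (j : {i // i ∈ I ∧ pairing (l i) v = b i}) _ =>
        mul_nonneg (sub_nonneg.2 (hFP hx j j.2.1)) (hcu j)).1 h.symm i (Finset.mem_univ _)
    linarith [(mul_eq_zero.1 h).resolve_right hi.ne']
  have hspan : vectorSpan ℝ F = LinearMap.ker (pairingHom (l i)) := by
    refine Submodule.eq_of_le_of_finrank_eq (vectorSpan_le_ker hFi) ?_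
    have := finrank_ker_add_one (w := l i) (x := fun k => (u i k : ℝ)) (by rw [h₁ i]; norm_num)
    rw [affDim, hdim] at hFd
    omega
  have hker : vectorSpan ℝ F ≤ LinearMap.ker (c : (Fin n → ℝ) →ₗ[ℝ] ℝ) := by
    refine Submodule.span_le.2 ?_
    rintro _ ⟨x, hx, y, hy, rfl⟩
    simp [(hFiff x (hFP hx)).1 hx, (hFiff y (hFP hy)).1 hy]
  refine ⟨i, hFi.antisymm fun x hx => (hFiff x hx.1).2 ?_⟩
  have hmem : x - v ∈ vectorSpan ℝ F := by
    rw [hspan, LinearMap.mem_ker, pairingHom_apply, pairing_sub, hx.2, i.2.2, sub_self]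
  have := hker hmem
  rw [LinearMap.mem_ker] at this
  exact sub_eq_zero.1 (by simpa using this)

end Vertex

theorem IsUnimodular.isDelzant (h : IsUnimodular I l b) : IsDelzant (polyhedron I l b) := by
  refine ⟨⟨_, finite_extremePoints, polyhedron_eq_convexHull h.bounded⟩, h.affDim_eq, ?_⟩
  intro v hv
  obtain ⟨a, ha⟩ := h.exists_basis hv
  obtain ⟨u, h₁, h₀⟩ := h.exists_dual hv
  let e : {i // i ∈ I ∧ pairing (l i) v = b i} ≃
      {F : Set (Fin n → ℝ) // IsFacet (polyhedron I l b) F ∧ v ∈ F} :=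
    Equiv.ofBijective
      (fun i => ⟨tightFace I l b i, isFacet_tightFace hv h₁ h₀ h.affDim_eq i, hv.1, i.2.2⟩)
      ⟨fun i j hij => tightFace_injective hv h₁ h₀ (Subtype.ext_iff.1 hij), fun F => by
        obtain ⟨i, hi⟩ := exists_eq_tightFace hv h₁ h₀ h.affDim_eq F.2.1 F.2.2
        exact ⟨i, Subtype.ext hi.symm⟩⟩
  refine ⟨a.reindex e, fun F => ?_⟩
  obtain ⟨i, rfl⟩ := e.surjective F
  rw [Module.Basis.reindex_apply, Equiv.symm_apply_apply, ha]
  refine ⟨fun h0 => ?_, tightFace_eq i.2.1 hv.1 i.2.2⟩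
  have := h₁ i
  rw [h0] at this
  simp [pairing] at this

end Delzant

end Nesto

namespace Nesto

/-! ### The cube as starting point -/

section Cube

variable {n : ℕ}

theorem single_pairing (i : Fin n) (x : Fin n → ℝ) : pairing (Pi.single i 1) x = x i := by
  simp [pairing, Pi.single_apply]

theorem neg_pairing (w : Fin n → ℤ) (x : Fin n → ℝ) : pairing (-w) x = -pairing w x := by
  simp [pairing]

/-- The normals `± e_i` are their own dual family: two opposite ones cannot be tight at one point,
and the remaining pairs are orthogonal. -/
theorem isUnimodular_of_bijOn {ι : Type*} {I : Finset ι} {l : ι → Fin n → ℤ} {b : ι → ℝ}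
    (hl : Set.BijOn l I (cubeNormals n)) (hb : ∀ i ∈ I, b i = 1) : IsUnimodular I l b := by
  refine ⟨?_, ⟨0, fun i hi => ?_⟩, fun v _ => ⟨l, fun i hi hti j hj htj => ⟨?_, fun hij => ?_⟩⟩⟩
  · refine Metric.isBounded_Icc (-1 : Fin n → ℝ) 1 |>.subset fun x hx => ⟨fun k => ?_, fun k => ?_⟩
    · obtain ⟨i, hi, hlk⟩ := hl.surjOn (show -Pi.single k 1 ∈ cubeNormals n from ⟨k, Or.inr rfl⟩)
      have := hx i hi
      rw [hlk, hb i hi, neg_pairing, single_pairing] at this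
      simp only [Pi.neg_apply, Pi.one_apply]
      linarith
    · obtain ⟨i, hi, hlk⟩ := hl.surjOn (show Pi.single k 1 ∈ cubeNormals n from ⟨k, Or.inl rfl⟩)
      have := hx i hi
      rwa [hlk, hb i hi, single_pairing] at this
  · rw [hb i hi]
    simp [pairing]
  · rintro rfl
    obtain ⟨k, hk | hk⟩ := hl.mapsTo hi <;> rw [hk]
    · simp [single_pairing]
    · simp [neg_pairing, single_pairing]
  · rw [hb i hi] at hti
    rw [hb j hj] at htj
    have hne : l i ≠ l j := fun h => hij (hl.injOn hi hj h)
    obtain ⟨k, hk⟩ := hl.mapsTo hi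
    obtain ⟨m, hm⟩ := hl.mapsTo hj
    have hkm : k ≠ m := by
      rintro rfl
      rcases hk with hk | hk <;> rcases hm with hm | hm <;> rw [hk] at hti hne <;>
        rw [hm] at htj hne <;> simp only [neg_pairing, single_pairing] at hti htj <;>
        first | exact hne rfl | linarith
    rcases hk with hk | hk <;> rcases hm with hm | hm <;> rw [hk, hm] <;>
      simp [neg_pairing, single_pairing, hkm]

end Cube

/-! ### Induction over the shavings -/

namespace CubeShaving

open Finset

variable {n : ℕ} {B : Finset (Finset (Fin (n + 1)))} (R : CubeShaving B)

theorem chain_subset_succ {i : ℕ} (hi : i < R.N) : R.chain i ⊆ R.chain (i + 1) :=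
  (Finset.subset_insert _ _).trans (R.chain_succ i hi).1.2

theorem chain_mono {i j : ℕ} (hij : i ≤ j) (hj : j ≤ R.N) : R.chain i ⊆ R.chain j := by
  induction j, hij using Nat.le_induction with
  | base => exact subset_rfl
  | succ k _ ih => exact (ih (by omega)).trans (R.chain_subset_succ (by omega))

theorem chain_subset {i : ℕ} (hi : i ≤ R.N) : R.chain i ⊆ B :=
  (R.chain_mono hi le_rfl).trans R.chain_last.subset

theorem chain_isBuildingSet {i : ℕ} (hi : i ≤ R.N) : IsBuildingSet (R.chain i) := by
  cases i with
  | zero => exact R.chain_zero_isBuildingSet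
  | succ k => exact (R.chain_succ k (by omega)).1.1

theorem exists_step (j : Fin R.M) :
    ∃ i < R.N, R.T j ∈ R.chain (i + 1) ∧ R.T j ∉ R.chain i := by
  classical
  obtain ⟨hB, h0⟩ := (R.T_range (R.T j)).1 ⟨j, rfl⟩
  have hex : ∃ i, R.T j ∈ R.chain i := ⟨R.N, by rwa [R.chain_last]⟩
  obtain ⟨i, hi⟩ : ∃ i, Nat.find hex = i + 1 :=
    Nat.exists_eq_succ_of_ne_zero fun h => h0 (h ▸ Nat.find_spec hex)
  have hle : Nat.find hex ≤ R.N := Nat.find_min' hex (by rwa [R.chain_last])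
  exact ⟨i, by omega, hi ▸ Nat.find_spec hex, Nat.find_min hex (by omega)⟩

/-- The elements of `B_{i+1} \ B_i` are disjoint unions of two elements of `B_i`. -/
theorem exists_disjoint_union (hB : IsBuildingSet B) (hconn : univ ∈ B)
    (hflag : IsFlag (nestohedron B)) {i : ℕ} (hi : i < R.N) {U : Finset (Fin (n + 1))}
    (hU : U ∈ R.chain (i + 1)) (hUi : U ∉ R.chain i) :
    ∃ S ∈ R.chain i, ∃ T ∈ R.chain i, Disjoint S T ∧ S ∪ T = U := by
  have hBi := R.chain_isBuildingSet hi.le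
  obtain ⟨⟨hgB, hgi⟩, hmin⟩ := R.gen_minimal i hi
  have hgu : R.gen i ≠ univ := fun h =>
    hgi (h ▸ R.chain_mono (Nat.zero_le i) hi.le R.univ_mem_chain_zero)
  have hgs : ∀ k, R.gen i ≠ {k} := fun k h => hgi (h ▸ hBi.singleton_mem k)
  obtain ⟨X, hX, Y, hY, hdisj, hXY⟩ :=
    exists_disjoint_union_of_isFlag hB hconn hflag hgB hgu hgs
  -- The generator is minimal among the elements of `B` still missing, so its proper part `X` is
  -- already present.
  have hXi : X ∈ R.chain i := by
    by_contra h
    have hsub : X ∪ Y ⊆ X := hXY.subset.trans (hmin ⟨hX, h⟩ (hXY ▸ subset_union_left))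
    obtain ⟨k, hk⟩ := hB.nonempty_of_mem Y hY
    exact Finset.disjoint_left.1 hdisj (hsub (mem_union_right _ hk)) hk
  have hYi : Y ∈ R.chain i := by
    by_contra h
    have hsub : X ∪ Y ⊆ Y := hXY.subset.trans (hmin ⟨hY, h⟩ (hXY ▸ subset_union_right))
    obtain ⟨k, hk⟩ := hB.nonempty_of_mem X hX
    exact Finset.disjoint_left.1 hdisj hk (hsub (mem_union_left _ hk))
  have hC := R.chain_succ i hi
  rw [← hXY] at hC
  exact exists_disjoint_union_of_closure hBi hXi hYi hC hU hUi

/-- The indices of the inequalities of the cube and of the first `j` shavings. -/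
def indices (j : ℕ) : Finset (Finset (Fin (n + 1))) :=
  (R.chain 0).erase univ ∪ ({k : Fin R.M | (k : ℕ) < j} : Finset _).image R.T

theorem mem_indices {j : ℕ} {S : Finset (Fin (n + 1))} :
    S ∈ R.indices j ↔ (S ≠ univ ∧ S ∈ R.chain 0) ∨ ∃ k : Fin R.M, (k : ℕ) < j ∧ R.T k = S := by
  simp [indices]

theorem polyhedron_indices (j : Fin R.M) :
    polyhedron (R.indices j) R.l R.b = {x : Fin n → ℝ |
        (∀ S ∈ R.chain 0, S ≠ univ → pairing (R.l S) x ≤ R.b S) ∧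
        ∀ k < j, pairing (R.l (R.T k)) x ≤ R.b (R.T k)} := by
  ext x
  simp only [polyhedron, mem_indices, Set.mem_ofPred_eq]
  constructor
  · exact fun h => ⟨fun S hS hu => h S (Or.inl ⟨hu, hS⟩), fun k hk => h _ (Or.inr ⟨k, hk, rfl⟩)⟩
  · rintro ⟨h₁, h₂⟩ S (⟨hu, hS⟩ | ⟨k, hk, rfl⟩)
    · exact h₁ S hS hu
    · exact h₂ k hk

theorem indices_succ (j : Fin R.M) : R.indices (j + 1) = insert (R.T j) (R.indices j) := by
  ext S
  simp only [mem_insert, mem_indices, Nat.lt_succ_iff_lt_or_eq]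
  constructor
  · rintro (h | ⟨k, hk | hk, rfl⟩)
    · exact Or.inr (Or.inl h)
    · exact Or.inr (Or.inr ⟨k, hk, rfl⟩)
    · exact Or.inl (congrArg R.T (Fin.ext hk))
  · rintro (rfl | h | ⟨k, hk, rfl⟩)
    · exact Or.inr ⟨j, Or.inr rfl, rfl⟩
    · exact Or.inl h
    · exact Or.inr ⟨k, Or.inl hk, rfl⟩

theorem T_notMem_indices (j : Fin R.M) : R.T j ∉ R.indices j := by
  rw [mem_indices]
  rintro (h | ⟨k, hk, h⟩)
  · exact ((R.T_range _).1 ⟨j, rfl⟩).2 h.2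
  · exact hk.ne (congrArg Fin.val (R.T_injective h))

/-- The numbering respects the chain, so the inequalities of both parts of a set are available
before it is shaved. -/
theorem mem_indices_of_mem_chain {i : ℕ} (hi : i ≤ R.N) {j : Fin R.M} (hj : R.T j ∉ R.chain i)
    {S : Finset (Fin (n + 1))} (hS : S ∈ R.chain i) (hSu : S ≠ univ) : S ∈ R.indices j := by
  rw [mem_indices]
  by_cases h0 : S ∈ R.chain 0
  · exact Or.inl ⟨hSu, h0⟩
  · obtain ⟨k, rfl⟩ := (R.T_range S).2 ⟨R.chain_subset hi hS, h0⟩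
    exact Or.inr ⟨k, R.T_chain i hi k j hS hj, rfl⟩

theorem indices_last : R.indices R.M = B.erase univ := by
  ext S
  simp only [mem_indices, mem_erase]
  constructor
  · rintro (⟨hu, h⟩ | ⟨k, -, rfl⟩)
    · exact ⟨hu, R.chain_zero_subset h⟩
    · obtain ⟨hB, h0⟩ := (R.T_range _).1 ⟨k, rfl⟩
      exact ⟨fun h => h0 (h ▸ R.univ_mem_chain_zero), hB⟩
  · rintro ⟨hu, hB⟩
    by_cases h0 : S ∈ R.chain 0
    · exact Or.inl ⟨hu, h0⟩
    · obtain ⟨k, rfl⟩ := (R.T_range S).2 ⟨hB, h0⟩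
      exact Or.inr ⟨k, k.2, rfl⟩

theorem isUnimodular_indices (hB : IsBuildingSet B) (hconn : univ ∈ B)
    (hflag : IsFlag (nestohedron B)) {j : ℕ} (hj : j ≤ R.M) :
    IsUnimodular (R.indices j) R.l R.b := by
  induction j with
  | zero =>
    refine isUnimodular_of_bijOn ?_ fun S hS => ?_
    · convert R.l_cube.1 using 1
      ext S
      simp [mem_indices, and_comm]
    · have : S ≠ univ ∧ S ∈ R.chain 0 := by simpa [mem_indices] using hS
      exact R.b_cube S this.2 this.1
  | succ j ih =>
    have ih := ih (by omega)
    set k : Fin R.M := ⟨j, hj⟩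
    obtain ⟨i, hi, hki, hki'⟩ := R.exists_step k
    obtain ⟨S, hS, T, hT, hdisj, hST⟩ := R.exists_disjoint_union hB hconn hflag hi hki hki'
    have hBi := R.chain_isBuildingSet hi.le
    have hSne := hBi.nonempty_of_mem S hS
    have hTne := hBi.nonempty_of_mem T hT
    have hne : S ≠ T := fun h => hSne.ne_empty (disjoint_self.1 (h ▸ hdisj))
    -- The full set carries no inequality, so neither part may be the full set.
    have hSu : S ≠ univ := by
      rintro rfl
      exact hTne.ne_empty (disjoint_self.1 (hdisj.mono_left (subset_univ T)))
    have hTu : T ≠ univ := by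
      rintro rfl
      exact hSne.ne_empty (disjoint_self.1 (hdisj.mono_right (subset_univ S)))
    have hdec : IsDecomposition (R.chain i) (R.T k) {S, T} := by
      rw [← hST]
      exact isDecomposition_pair hBi hS hT hdisj (hST ▸ hki')
    have hb := R.b_rec i hi k hki hki' S T hne hdec
    rw [show j + 1 = (k : ℕ) + 1 from rfl, indices_succ]
    refine ih.insert (R.T_notMem_indices k) (R.mem_indices_of_mem_chain hi.le hki' hS hSu)
      (R.mem_indices_of_mem_chain hi.le hki' hT hTu) hne
      (R.l_rec i hi k hki hki' S T hne hdec) (by linarith [R.ε_pos k]) fun v hv => ?_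
    refine R.ε_small i hi k hki hki' S T hne hdec v ?_
    rw [← polyhedron_indices]
    exact hv

theorem polytope_eq : R.polytope = polyhedron (B.erase univ) R.l R.b := by
  ext x
  simp only [polytope, polyhedron, Set.mem_ofPred_eq, mem_erase]
  exact ⟨fun h S hS => h S hS.2 hS.1, fun h S hS hu => h S ⟨hu, hS⟩⟩

end CubeShaving

end Nesto

/-! ### Conclusion for the complete system of inequalities -/

theorem mainTheorem7 {n : ℕ} (B : Finset (Finset (Fin (n + 1))))
    (hB : Nesto.IsBuildingSet B) (hconn : Finset.univ ∈ B)
    (hflag : Nesto.IsFlag (Nesto.nestohedron B)) (R : Nesto.CubeShaving B) :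
    Nesto.IsDelzant R.polytope ∧
      ∀ v ∈ R.polytope.extremePoints ℝ,
        ∃ a : Module.Basis
            {S : Finset (Fin (n + 1)) //
              S ∈ B ∧ S ≠ Finset.univ ∧ Nesto.pairing (R.l S) v = R.b S} ℤ (Fin n → ℤ),
          ∀ S, a S = R.l S.1 := by
  have h := R.isUnimodular_indices hB hconn hflag le_rfl
  rw [R.indices_last] at h
  rw [R.polytope_eq]
  refine ⟨h.isDelzant, fun v hv => ?_⟩
  obtain ⟨a, ha⟩ := h.exists_basis hv
  let e : {S // S ∈ B.erase Finset.univ ∧ Nesto.pairing (R.l S) v = R.b S} ≃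
      {S // S ∈ B ∧ S ≠ Finset.univ ∧ Nesto.pairing (R.l S) v = R.b S} :=
    Equiv.subtypeEquivRight fun S => by rw [Finset.mem_erase]; tauto
  refine ⟨a.reindex e, fun S => ?_⟩
  rw [Module.Basis.reindex_apply, ha]
  rfl
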